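/- Let $V=(V_n)_{n\ge 1}$ be a bounded real sequence and let $H$ be the half-line discrete Schrödinger operator on $\ell^2(\{1,2,\dots\})$, $(H\psi)_n=\psi_{n+1}+\psi_{n-1}+V_n\psi_n$ with $\psi_0=0$. For real $q\ge 0$ and $T>0$ put $$P(q,T)=\sum_{n>q}\frac2T\int_0^\infty |\langle \delta_n,e^{-itH}\delta_1\rangle|^2e^{-2t/T}\,dt ,$$ and define, as suprema in $[0,\infty]$ (with $\sup\emptyset=0$), $$\alpha_u^+=\sup\Big\{a>0:\limsup_{T\to\infty}\frac{\log P(T^a,T)}{\log T}>-\infty\Big\},\qquad \alpha_u^-=\sup\Big\{a>0:\liminf_{T\to\infty}\frac{\log P(T^a,T)}{\log T}>-\infty\Big\}.$$ For an integer $q>1$ let $H^q(k)$ be the $q\times q$ matrix obtained by restricting $H$ to $\{1,\dots,q\}$ with boundary conditions $\psi_{q+1}=e^{ik}\psi_1$, $\psi_0=e^{-ik}\psi_q$, and let $\mathfrak E_q\subset\mathbb R$ be the set of eigenvalues of $H^q(\pi/2)$. For $\varepsilon>0$, say that $\mathfrak E_q$ is $(\varepsilon,\xi)$-clustered if there are finitely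 many disjoint closed intervals $I_1,\dots,I_k$ ($k\le q$), each of length at most $\varepsilon$, whose union contains $\mathfrak E_q$, such that every $I_j$ contains at least $q^\xi$ points of $\mathfrak E_q$. Let $2/3<\xi\le 1$ and $0<\alpha<1$, and let $(q_\ell)_{\ell\ge1}$ be a sequence of integers $q_\ell>1$ with $q_\ell\to\infty$ such that $\mathfrak E_{q_\ell}$ is $(q_\ell^{-1/\alpha},\xi)$-clustered for every $\ell$. Then $\alpha_u^-\le\alpha$. If, moreover, $(q_\ell)$ is exponentially growing, that is, $\sup_\ell q_{\ell+1}/q_\ell<\infty$ and $\inf_\ell q_{\ell+1}/q_\ell>1$, then $\alpha_u^+\le\alpha$. -/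

import Mathlib

open Filter MeasureTheory Topology
open scoped ENNReal

noncomputable section

namespace HalfLine

/-- The Hilbert space `ℓ²` of the half line `{1, 2, 3, …}`.  Throughout, the coordinate with index
`n : ℕ` belongs to the site `n + 1`. -/
abbrev Space : Type := lp (fun _ : ℕ => ℂ) 2

/-- The left neighbour `ψ_{m-1}` of a site, with the Dirichlet condition `ψ_0 = 0`. -/
def leftNbr (ψ : ℕ → ℂ) : ℕ → ℂ
  | 0 => 0
  | n + 1 => ψ n

/-- The formal action `(H ψ)_m = ψ_{m+1} + ψ_{m-1} + V_m ψ_m` on all sequences. -/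
def action (V : ℕ → ℝ) (ψ : ℕ → ℂ) (n : ℕ) : ℂ :=
  ψ (n + 1) + leftNbr ψ n + (V n : ℂ) * ψ n

theorem action_add (V : ℕ → ℝ) (ψ φ : ℕ → ℂ) : action V (ψ + φ) = action V ψ + action V φ := by
  funext n
  cases n <;> simp only [action, leftNbr, Pi.add_apply] <;> ring

theorem action_smul (V : ℕ → ℝ) (c : ℂ) (ψ : ℕ → ℂ) : action V (c • ψ) = c • action V ψ := by
  funext n
  cases n <;> simp only [action, leftNbr, Pi.smul_apply, smul_eq_mul] <;> ring

theorem hasSum_sq (ψ : Space) : HasSum (fun n => ‖ψ n‖ ^ 2) (‖ψ‖ ^ 2) := by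
  have h := lp.hasSum_norm (p := 2) (by norm_num) ψ
  simpa using h

theorem action_bound (V : ℕ → ℝ) (C : ℝ) (hC : ∀ n, |V n| ≤ C) (ψ : Space) :
    Summable (fun n => ‖action V ψ n‖ ^ 2) ∧
      ∑' n, ‖action V ψ n‖ ^ 2 ≤ (3 * (2 + C ^ 2)) * ‖ψ‖ ^ 2 := by
  have h0 := hasSum_sq ψ
  have hR : Summable (fun n => ‖ψ (n + 1)‖ ^ 2) := (summable_nat_add_iff 1).2 h0.summable
  have hRle : ∑' n, ‖ψ (n + 1)‖ ^ 2 ≤ ‖ψ‖ ^ 2 := by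
    have := h0.summable.tsum_eq_zero_add
    rw [h0.tsum_eq] at this
    nlinarith [sq_nonneg ‖ψ 0‖]
  have hL : HasSum (fun n => ‖leftNbr ψ n‖ ^ 2) (‖ψ‖ ^ 2) := by
    refine (hasSum_nat_add_iff' 1).1 ?_
    simpa [leftNbr] using h0
  have hpt : ∀ n, ‖action V ψ n‖ ^ 2 ≤
      3 * (‖ψ (n + 1)‖ ^ 2 + ‖leftNbr ψ n‖ ^ 2 + C ^ 2 * ‖ψ n‖ ^ 2) := by
    intro n
    have h1 : ‖action V ψ n‖ ≤ ‖ψ (n + 1)‖ + ‖leftNbr ψ n‖ + C * ‖ψ n‖ := by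
      refine (norm_add₃_le).trans ?_
      have : ‖(V n : ℂ) * ψ n‖ ≤ C * ‖ψ n‖ := by
        rw [norm_mul, Complex.norm_real, Real.norm_eq_abs]
        exact mul_le_mul_of_nonneg_right (hC n) (norm_nonneg _)
      linarith
    have h2 := pow_le_pow_left₀ (norm_nonneg _) h1 2
    nlinarith [sq_nonneg (‖ψ (n + 1)‖ - ‖leftNbr ψ n‖), sq_nonneg (‖ψ (n + 1)‖ - C * ‖ψ n‖),
      sq_nonneg (‖leftNbr ψ n‖ - C * ‖ψ n‖)]
  have hs : Summable (fun n =>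
      3 * (‖ψ (n + 1)‖ ^ 2 + ‖leftNbr ψ n‖ ^ 2 + C ^ 2 * ‖ψ n‖ ^ 2)) :=
    ((hR.add hL.summable).add (h0.summable.mul_left _)).mul_left _
  have hsum : Summable (fun n => ‖action V ψ n‖ ^ 2) :=
    Summable.of_nonneg_of_le (fun n => sq_nonneg _) hpt hs
  refine ⟨hsum, (hsum.tsum_le_tsum hpt hs).trans ?_⟩
  rw [tsum_mul_left, (hR.add hL.summable).tsum_add (h0.summable.mul_left _),
    hR.tsum_add hL.summable, tsum_mul_left, hL.tsum_eq, h0.tsum_eq]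
  nlinarith

theorem action_memℓp (V : ℕ → ℝ) (hV : ∃ C : ℝ, ∀ n, |V n| ≤ C) (ψ : Space) :
    Memℓp (action V ψ) 2 := by
  obtain ⟨C, hC⟩ := hV
  refine memℓp_gen ?_
  simpa using (action_bound V C hC ψ).1

/-- The discrete Schrödinger operator `H = Δ + V` on the half line, with a bounded real
potential `V` (`V n` is the value at the site `n + 1`), as a bounded operator on `ℓ²`. -/
def hamiltonian (V : ℕ → ℝ) (hV : ∃ C : ℝ, ∀ n, |V n| ≤ C) : Space →L[ℂ] Space :=
  LinearMap.mkContinuousOfExistsBound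
    { toFun := fun ψ => ⟨action V ψ, action_memℓp V hV ψ⟩
      map_add' := fun ψ φ => Subtype.ext (action_add V ψ φ)
      map_smul' := fun c ψ => Subtype.ext (action_smul V c ψ) }
    (by
      obtain ⟨C, hC⟩ := hV
      refine ⟨Real.sqrt (3 * (2 + C ^ 2)), fun ψ => ?_⟩
      refine le_of_sq_le_sq ?_ (by positivity)
      rw [mul_pow, Real.sq_sqrt (by positivity), ← (hasSum_sq _).tsum_eq]
      exact (action_bound V C hC ψ).2)

theorem hamiltonian_apply (V : ℕ → ℝ) (hV : ∃ C : ℝ, ∀ n, |V n| ≤ C) (ψ : Space) (n : ℕ) :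
    hamiltonian V hV ψ n = ψ (n + 1) + leftNbr ψ n + (V n : ℂ) * ψ n :=
  rfl

/-- The unit vector at the site `n + 1`. -/
def delta (n : ℕ) : Space := lp.single 2 n (1 : ℂ)

/-- The time evolution `e^{-itH}`. -/
def evolution (V : ℕ → ℝ) (hV : ∃ C : ℝ, ∀ n, |V n| ≤ C) (t : ℝ) : Space →L[ℂ] Space :=
  NormedSpace.exp ((-(Complex.I * (t : ℂ))) • hamiltonian V hV)

/-- The time-averaged portion of the wave packet started at the site `1` which lies outside
`{1, …, q}`: `P(q,T) = ∑_{m > q} (2/T) ∫_0^∞ |⟨δ_m, e^{-itH} δ_1⟩|² e^{-2t/T} dt`. -/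
def outsideProb (V : ℕ → ℝ) (hV : ∃ C : ℝ, ∀ n, |V n| ≤ C) (q T : ℝ) : ℝ≥0∞ :=
  ∑' n : {n : ℕ // q < (n : ℝ) + 1},
    ENNReal.ofReal (2 / T) *
      ∫⁻ t in Set.Ioi (0 : ℝ),
        ENNReal.ofReal
          (‖inner ℂ (delta n) (evolution V hV t (delta 0))‖ ^ 2 * Real.exp (-2 * t / T))

/-- `log P(T^a, T) / log T`, with values in the extended reals. -/
def logRate (V : ℕ → ℝ) (hV : ∃ C : ℝ, ∀ n, |V n| ≤ C) (a T : ℝ) : EReal :=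
  ENNReal.log (outsideProb V hV (T ^ a) T) / ((Real.log T : ℝ) : EReal)

/-- `α_u^+`, a supremum of positive reals taken in `[0, ∞]`. -/
def alphaUpperPlus (V : ℕ → ℝ) (hV : ∃ C : ℝ, ∀ n, |V n| ≤ C) : ℝ≥0∞ :=
  sSup (ENNReal.ofReal '' {a : ℝ | 0 < a ∧ ⊥ < limsup (fun T : ℝ => logRate V hV a T) atTop})

/-- `α_u^-`, a supremum of positive reals taken in `[0, ∞]`. -/
def alphaUpperMinus (V : ℕ → ℝ) (hV : ∃ C : ℝ, ∀ n, |V n| ≤ C) : ℝ≥0∞ :=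
  sSup (ENNReal.ofReal '' {a : ℝ | 0 < a ∧ ⊥ < liminf (fun T : ℝ => logRate V hV a T) atTop})

/-- The restriction `H^q(k)` of `H` to the sites `1, …, q` with the boundary condition
`ψ_{q+1} = e^{ik} ψ_1` (and `ψ_0 = e^{-ik} ψ_q`).  The corner entries are added, which for `q = 2`
is what the boundary condition says. -/
def truncation (V : ℕ → ℝ) (q : ℕ) (k : ℝ) : Matrix (Fin q) (Fin q) ℂ :=
  Matrix.of fun i j =>
    (if i = j then (V i : ℂ) else 0) +
    (if (j : ℕ) = i + 1 then 1 else 0) +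
    (if (i : ℕ) = j + 1 then 1 else 0) +
    (if (i : ℕ) = 0 ∧ (j : ℕ) + 1 = q then Complex.exp (-(Complex.I * (k : ℂ))) else 0) +
    (if (i : ℕ) + 1 = q ∧ (j : ℕ) = 0 then Complex.exp (Complex.I * (k : ℂ)) else 0)

/-- The set of eigenvalues of `H^q(π/2)`. -/
def eigenvalueSet (V : ℕ → ℝ) (q : ℕ) : Set ℝ :=
  {E : ℝ | Module.End.HasEigenvalue (Matrix.toLin' (truncation V q (Real.pi / 2))) (E : ℂ)}

/-- `S` is `(ε, ξ)`-clustered at size `q`: it is covered by `k ≤ q` disjoint closed intervals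
`[a j, b j]` of length at most `ε`, each of which contains at least `q^ξ` points of `S`. -/
def IsClustered (S : Set ℝ) (q : ℕ) (ε ξ : ℝ) : Prop :=
  ∃ (k : ℕ) (a b : Fin k → ℝ), k ≤ q ∧
    (∀ j, a j ≤ b j ∧ b j - a j ≤ ε) ∧
    (∀ i j, i ≠ j → Disjoint (Set.Icc (a i) (b i)) (Set.Icc (a j) (b j))) ∧
    S ⊆ ⋃ j, Set.Icc (a j) (b j) ∧
    ∀ j, (q : ℝ) ^ ξ ≤ ((S ∩ Set.Icc (a j) (b j)).ncard : ℝ)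

/-- A sequence of nonnegative numbers grows exponentially if the supremum of its successive
quotients is finite and their infimum is larger than `1`. -/
def ExponentiallyGrowing (a : ℕ → ℝ) : Prop :=
  (∀ n, 0 ≤ a n) ∧ BddAbove (Set.range fun n => a (n + 1) / a n) ∧ 1 < ⨅ n, a (n + 1) / a n

end HalfLine

end

/-! Everything rests on one estimate: if `1 < q ≤ r`, `T ≥ 1`, the zero set is `(ε, ξ)`-clustered at
size `q` with `4Tε ≤ e⁻²`, and `q^ξ ≥ 2`, then `P(r,T) ≤ K T¹⁴ exp(-q^ξ)`
(`outsideProb_le_of_isClustered`). For `a > α`, `ε = q^(-1/α)` and `T^a` comparable to `q`, the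
product `Tε` tends to `0` as a power of `q`, so `P(T^a,T)` decays faster than every power of `T`.
Such `T` form an unbounded set, which settles the liminf; if the ratios of the `q_ℓ` are bounded,
every large `T` is of this kind for some `ℓ`, which settles the limsup.

The estimate has three ingredients, with `η = 1/(2T)` and `Δ` the trace of the transfer matrix over
`q` sites.

Dynamics to resolvent: the damped wave packet has the resolvent vector `(H-z)⁻¹δ₁` on the line `Im z
= η` as its Fourier transform, so a bound of order `(1+x²)⁻¹` for the part beyond `q` gives a
pointwise bound in time (`norm_tailProj_wave_le`).

Resolvent to discriminant: by the Wronskian and Green identities, that part is at most a power of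
`1/η` divided by `|Δ(z)|` (`norm_tailProj_resolventVec`).

Clusters to a large discriminant: the set in question consists of the zeros of `Δ`, which are real
and simple, and `|Δ| ≥ 2` at each critical point. By Rolle there is a critical point between any two
zeros in a cluster. For real `x` between adjacent such points `c`, `c'`, concavity of `log` compares
`∑ log |x-E|` with the weighted mean of `log |Δ(c)|` and `log |Δ(c')|`, both nonnegative; at most
two zeros lie in between and spoil this. Moving up to height `η`, far above the width `ε`, gains a
fixed amount for each of the remaining zeros in the cluster of the nearer point, at least `q^ξ - 2`
of them (`ClusterCover.lower`). -/

namespace HalfLine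

/-! ### Solutions off the real axis and decay of the resolvent -/

open Polynomial ComplexConjugate

/-- `s` solves the eigenvalue equation `s_{m+1} + s_{m-1} + V_m s_m = z s_m` at every site
`m ≥ 1`; the value `s n` belongs to the site `n`. -/
def IsSol (V : ℕ → ℝ) (z : ℂ) (s : ℕ → ℂ) : Prop :=
  ∀ n, s (n + 2) + s n + V n * s (n + 1) = z * s (n + 1)

/-- The solution of the eigenvalue equation with initial values `a`, `b` at the sites `0`, `1`,
as a sequence of polynomials in the energy. -/
noncomputable def solPoly (V : ℕ → ℝ) (a b : ℝ[X]) : ℕ → ℝ[X]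
  | 0 => a
  | 1 => b
  | n + 2 => (X - C (V n)) * solPoly V a b (n + 1) - solPoly V a b n

/-- The solution with Dirichlet initial values `0`, `1`. -/
noncomputable def dirichletSol (V : ℕ → ℝ) (z : ℂ) (n : ℕ) : ℂ := aeval z (solPoly V 0 1 n)

/-- The solution with Neumann initial values `1`, `0`. -/
noncomputable def neumannSol (V : ℕ → ℝ) (z : ℂ) (n : ℕ) : ℂ := aeval z (solPoly V 1 0 n)

/-- The trace of the transfer matrix over `q` sites, as a polynomial in the energy. -/
noncomputable def discriminant (V : ℕ → ℝ) (q : ℕ) : ℝ[X] :=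
  solPoly V 0 1 (q + 1) + solPoly V 1 0 q

variable {V : ℕ → ℝ} {z : ℂ} {s t : ℕ → ℂ}

theorem aeval_discriminant (V : ℕ → ℝ) (q : ℕ) (z : ℂ) :
    aeval z (discriminant V q) = dirichletSol V z (q + 1) + neumannSol V z q := by
  simp [discriminant, dirichletSol, neumannSol]

theorem isSol_aeval_solPoly (V : ℕ → ℝ) (a b : ℝ[X]) (z : ℂ) :
    IsSol V z (fun n => aeval z (solPoly V a b n)) := by
  intro n
  simp only [solPoly, map_sub, map_mul, aeval_X, aeval_C, Complex.coe_algebraMap]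
  ring

theorem isSol_dirichletSol (V : ℕ → ℝ) (z : ℂ) : IsSol V z (dirichletSol V z) :=
  isSol_aeval_solPoly V 0 1 z

theorem isSol_neumannSol (V : ℕ → ℝ) (z : ℂ) : IsSol V z (neumannSol V z) :=
  isSol_aeval_solPoly V 1 0 z

@[simp] theorem dirichletSol_zero : dirichletSol V z 0 = 0 := by simp [dirichletSol, solPoly]
@[simp] theorem dirichletSol_one : dirichletSol V z 1 = 1 := by simp [dirichletSol, solPoly]
@[simp] theorem neumannSol_zero : neumannSol V z 0 = 1 := by simp [neumannSol, solPoly]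
@[simp] theorem neumannSol_one : neumannSol V z 1 = 0 := by simp [neumannSol, solPoly]

theorem IsSol.linearCombination (hs : IsSol V z s) (ht : IsSol V z t) (a b : ℂ) :
    IsSol V z (fun n => a * s n + b * t n) := by
  intro n
  linear_combination a * hs n + b * ht n

/-- A sequence that solves the equation at the sites `1, …, q` is determined by its values at the
sites `0` and `1`. -/
theorem eq_combination_of_le {q : ℕ}
    (hs : ∀ n < q, s (n + 2) + s n + V n * s (n + 1) = z * s (n + 1)) :
    ∀ n ≤ q + 1, s n = s 1 * dirichletSol V z n + s 0 * neumannSol V z n := by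
  have key : ∀ n ≤ q, s n = s 1 * dirichletSol V z n + s 0 * neumannSol V z n ∧
      s (n + 1) = s 1 * dirichletSol V z (n + 1) + s 0 * neumannSol V z (n + 1) := by
    intro n
    induction n with
    | zero => intro _; simp
    | succ n ih =>
      intro hn
      obtain ⟨h0, h1⟩ := ih (by omega)
      refine ⟨h1, ?_⟩
      have hd := isSol_dirichletSol V z n
      have hn' := isSol_neumannSol V z n
      linear_combination hs n (by omega) - s 1 * hd - s 0 * hn' + (z - V n) * h1 - h0
  intro n hn
  rcases n with _ | n
  · exact (key 0 (Nat.zero_le _)).1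
  · exact (key n (by omega)).2

theorem IsSol.wronskian_eq (hs : IsSol V z s) (ht : IsSol V z t) (n : ℕ) :
    s (n + 1) * t n - s n * t (n + 1) = s 1 * t 0 - s 0 * t 1 := by
  induction n with
  | zero => rfl
  | succ n ih =>
    rw [← ih]
    linear_combination t (n + 1) * hs n - s (n + 1) * ht n

theorem transfer_det (V : ℕ → ℝ) (z : ℂ) (n : ℕ) :
    dirichletSol V z (n + 1) * neumannSol V z n - dirichletSol V z n * neumannSol V z (n + 1) =
      1 := by
  simpa using (isSol_dirichletSol V z).wronskian_eq (isSol_neumannSol V z) n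

/-- The Green identity: `Im (s_{m+1} conj s_m)` increases by `Im z · |s_m|²`. -/
theorem im_mul_conj_succ {n : ℕ} (h : s (n + 2) + s n + V n * s (n + 1) = z * s (n + 1)) :
    (s (n + 2) * conj (s (n + 1))).im =
      (s (n + 1) * conj (s n)).im + z.im * ‖s (n + 1)‖ ^ 2 := by
  have h2 : s (n + 2) = z * s (n + 1) - s n - V n * s (n + 1) := by linear_combination h
  rw [h2, ← Complex.normSq_eq_norm_sq, Complex.normSq_apply]
  simp
  ring

/-- The Green identity telescopes. The flux on the left is monotone when `Im z > 0`, which is the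
source of the a priori bounds below. -/
theorem IsSol.im_mul_conj (hs : IsSol V z s) (n k : ℕ) :
    (s (n + k + 1) * conj (s (n + k))).im =
      (s (n + 1) * conj (s n)).im + z.im * ∑ m ∈ Finset.range k, ‖s (n + m + 1)‖ ^ 2 := by
  induction k with
  | zero => simp
  | succ k ih =>
    have h1 : (s (n + (k + 1) + 1) * conj (s (n + (k + 1)))).im =
        (s (n + k + 1) * conj (s (n + k))).im + z.im * ‖s (n + k + 1)‖ ^ 2 :=
      im_mul_conj_succ (hs (n + k))
    rw [Finset.sum_range_succ, mul_add, h1, ih, add_assoc]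

theorem norm_le_div_of_mul_sq_le {x y : ℂ} {η : ℝ} (hη : 0 < η)
    (h : η * ‖x‖ ^ 2 ≤ ‖x‖ * ‖y‖) : ‖x‖ ≤ ‖y‖ / η := by
  rcases eq_or_ne x 0 with rfl | hx
  · simp; positivity
  · have hx' : 0 < ‖x‖ := norm_pos_iff.2 hx
    rw [le_div_iff₀ hη]
    nlinarith

/-- The flux of the Neumann solution vanishes at the left end, so the flux at `q` dominates `Im z`
times its mass. -/
theorem norm_neumannSol_le (hz : 0 < z.im) {q : ℕ} (hq : 1 ≤ q) :
    ‖neumannSol V z q‖ ≤ ‖neumannSol V z (q + 1)‖ / z.im := by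
  refine norm_le_div_of_mul_sq_le hz ?_
  have h := (isSol_neumannSol V z).im_mul_conj 0 q
  simp only [zero_add, neumannSol_one, zero_mul, Complex.zero_im] at h
  have h1 : ‖neumannSol V z q‖ ^ 2 ≤ ∑ m ∈ Finset.range q, ‖neumannSol V z (m + 1)‖ ^ 2 := by
    obtain ⟨p, rfl⟩ := Nat.exists_eq_add_of_le' hq
    exact Finset.single_le_sum (f := fun m => ‖neumannSol V z (m + 1)‖ ^ 2)
      (fun _ _ => sq_nonneg _) (Finset.self_mem_range_succ p)
  calc z.im * ‖neumannSol V z q‖ ^ 2 ≤ (neumannSol V z (q + 1) * conj (neumannSol V z q)).im := by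
        rw [h]; gcongr
    _ ≤ ‖neumannSol V z (q + 1) * conj (neumannSol V z q)‖ :=
        (le_abs_self _).trans (Complex.abs_im_le_norm _)
    _ = _ := by rw [norm_mul, Complex.norm_conj, mul_comm]

/-- This bounds a Weyl function of the box: the combination of the two solutions that vanishes at `q
+ 1` has no flux there, so its flux at the left end is paid for by its mass alone. -/
theorem norm_neumannSol_le_dirichletSol (hz : 0 < z.im) {q : ℕ} (hq : 1 ≤ q) :
    ‖neumannSol V z (q + 1)‖ ≤ ‖dirichletSol V z (q + 1)‖ / z.im := by
  set a := dirichletSol V z (q + 1)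
  set b := neumannSol V z (q + 1)
  have hs := (isSol_neumannSol V z).linearCombination (isSol_dirichletSol V z) a (-b)
  have h := hs.im_mul_conj 0 q
  have h0 : a * neumannSol V z (q + 1) + -b * dirichletSol V z (q + 1) = 0 := by
    simp only [a, b]; ring
  simp only [zero_add, h0, zero_mul, Complex.zero_im, neumannSol_one, neumannSol_zero,
    dirichletSol_one, dirichletSol_zero, mul_zero, mul_one, add_zero] at h
  refine norm_le_div_of_mul_sq_le hz ?_
  have h1 : ‖b‖ ^ 2 ≤ ∑ m ∈ Finset.range q,
      ‖a * neumannSol V z (m + 1) + -b * dirichletSol V z (m + 1)‖ ^ 2 := by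
    have := Finset.single_le_sum
      (f := fun m => ‖a * neumannSol V z (m + 1) + -b * dirichletSol V z (m + 1)‖ ^ 2)
      (fun _ _ => sq_nonneg _) (Finset.mem_range.2 hq : 0 ∈ Finset.range q)
    simpa using this
  calc z.im * ‖b‖ ^ 2 ≤ z.im * ∑ m ∈ Finset.range q,
      ‖a * neumannSol V z (m + 1) + -b * dirichletSol V z (m + 1)‖ ^ 2 := by gcongr
    _ = -(-b * conj a).im := by linarith
    _ ≤ ‖-b * conj a‖ := (neg_le_abs _).trans (Complex.abs_im_le_norm _)
    _ = _ := by rw [norm_mul, Complex.norm_conj, norm_neg]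

/-- Reduces the trace to one entry of the transfer matrix, the one that occurs in the Green
function. -/
theorem norm_discriminant_le (hz : 0 < z.im) {q : ℕ} (hq : 1 ≤ q) :
    ‖aeval z (discriminant V q)‖ ≤ (1 + 1 / z.im ^ 2) * ‖dirichletSol V z (q + 1)‖ := by
  rw [aeval_discriminant]
  refine (norm_add_le _ _).trans ?_
  have h1 := norm_neumannSol_le (V := V) hz hq
  have h2 := norm_neumannSol_le_dirichletSol (V := V) hz hq
  have h3 : ‖neumannSol V z q‖ ≤ ‖dirichletSol V z (q + 1)‖ / z.im / z.im :=
    h1.trans (div_le_div_of_nonneg_right h2 hz.le)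
  have h4 : ‖dirichletSol V z (q + 1)‖ / z.im / z.im =
      1 / z.im ^ 2 * ‖dirichletSol V z (q + 1)‖ := by field_simp
  linarith

/-- For a solution that tends to zero, `Im z · ∑_{m > q} |u_m|² = -Im (u_{q+1} conj u_q)`. -/
theorem IsSol.hasSum_tail (hs : IsSol V z s) (hz : 0 < z.im) (h0 : Tendsto s atTop (𝓝 0)) (q : ℕ) :
    HasSum (fun m => ‖s (q + m + 1)‖ ^ 2) (-(s (q + 1) * conj (s q)).im / z.im) := by
  rw [hasSum_iff_tendsto_nat_of_nonneg (fun _ => sq_nonneg _)]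
  have hlim : Tendsto (fun k => (s (q + k + 1) * conj (s (q + k))).im) atTop (𝓝 0) := by
    have h1 : Tendsto (fun k => s (q + k)) atTop (𝓝 0) :=
      h0.comp (tendsto_atTop_mono (fun k => Nat.le_add_left k q) tendsto_id)
    have h2 : Tendsto (fun k => s (q + k + 1)) atTop (𝓝 0) :=
      h0.comp (tendsto_atTop_mono (fun k => by simp only [id]; omega) tendsto_id)
    have h3 : Tendsto (fun k => s (q + k + 1) * conj (s (q + k))) atTop (𝓝 (0 * conj 0)) :=
      h2.mul ((Complex.continuous_conj.tendsto 0).comp h1)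
    rw [map_zero, mul_zero] at h3
    exact (Complex.continuous_im.tendsto _).comp h3
  have := (hlim.sub_const (s (q + 1) * conj (s q)).im).div_const z.im
  rw [zero_sub] at this
  refine this.congr fun k => ?_
  rw [hs.im_mul_conj q k]
  field_simp
  ring

/-- The tail of a decaying solution normalised by `u_0 = -1` (that is, of the resolvent applied to
the unit vector at the first site) is controlled by the inverse of the discriminant. -/
theorem IsSol.tail_le (hs : IsSol V z s) (hz : 0 < z.im) (hlim : Tendsto s atTop (𝓝 0))
    (hs0 : s 0 = -1) {q : ℕ} (hq : 1 ≤ q) :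
    ‖aeval z (discriminant V q)‖ ^ 2 * ∑' m, ‖s (q + m + 1)‖ ^ 2 ≤
      (1 + 1 / z.im ^ 2) ^ 4 / z.im ^ 2 := by
  set η := z.im
  set φ := dirichletSol V z
  have hW : ∀ n, s (n + 1) * φ n - s n * φ (n + 1) = 1 := fun n => by
    have := hs.wronskian_eq (isSol_dirichletSol V z) n
    simpa [hs0] using this
  have hT : ∀ n, η * ‖s (n + 1)‖ ^ 2 ≤ -(s (n + 1) * conj (s n)).im := fun n => by
    have h := (hs.hasSum_tail hz hlim n).summable.sum_le_tsum (Finset.range 1)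
      (fun _ _ => sq_nonneg _)
    rw [(hs.hasSum_tail hz hlim n).tsum_eq, le_div_iff₀ hz] at h
    simp at h
    simp only [η]
    simp
    linarith
  have hφ : ∀ n, η * ‖φ (n + 1)‖ ^ 2 ≤ (φ (n + 2) * conj (φ (n + 1))).im := fun n => by
    have h := (isSol_dirichletSol V z).im_mul_conj 0 (n + 1)
    simp only [zero_add, dirichletSol_zero, map_zero, mul_zero, Complex.zero_im] at h
    rw [h]
    have : ‖φ (n + 1)‖ ^ 2 ≤ ∑ m ∈ Finset.range (n + 1), ‖φ (m + 1)‖ ^ 2 :=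
      Finset.single_le_sum (f := fun m => ‖φ (m + 1)‖ ^ 2) (fun _ _ => sq_nonneg _)
        (Finset.self_mem_range_succ n)
    exact mul_le_mul_of_nonneg_left this hz.le
  -- the diagonal of the resolvent
  have hdiag : ∀ n, 1 ≤ n → ‖s n‖ * ‖φ n‖ ≤ 1 / η := by
    intro n hn
    obtain ⟨p, rfl⟩ := Nat.exists_eq_add_of_le' hn
    have h1 := hW (p + 1)
    have h2 := hT (p + 1)
    have h3 := hφ p
    set a := s (p + 1)
    set b := s (p + 1 + 1)
    set x := φ (p + 1)
    set y := φ (p + 1 + 1)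
    -- The Wronskian relation `y/x - b/a = -1/(ax)`, cleared of denominators. Both `y/x` and `-b/a`
    -- have nonnegative imaginary part, the first at least `η`, so `|ax| ≤ 1/η`.
    have hid : (y * conj x).im * ‖a‖ ^ 2 - (b * conj a).im * ‖x‖ ^ 2 =
        -(conj a * conj x).im := by
      have h4 : y * conj x * (‖a‖ ^ 2 : ℝ) - b * conj a * (‖x‖ ^ 2 : ℝ) = -(conj a * conj x) := by
        rw [← Complex.normSq_eq_norm_sq, ← Complex.normSq_eq_norm_sq, ← Complex.mul_conj,
          ← Complex.mul_conj]
        linear_combination -(conj a * conj x) * h1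
      have := congrArg Complex.im h4
      rwa [Complex.sub_im, Complex.im_mul_ofReal, Complex.im_mul_ofReal, Complex.neg_im] at this
    have h5 : -(conj a * conj x).im ≤ ‖a‖ * ‖x‖ := by
      refine ((neg_le_abs _).trans (Complex.abs_im_le_norm _)).trans ?_
      rw [norm_mul, Complex.norm_conj, Complex.norm_conj]
    have h6 : η * ‖x‖ ^ 2 * ‖a‖ ^ 2 ≤ (y * conj x).im * ‖a‖ ^ 2 :=
      mul_le_mul_of_nonneg_right h3 (sq_nonneg _)
    have h7 : 0 ≤ -(b * conj a).im * ‖x‖ ^ 2 :=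
      mul_nonneg ((mul_nonneg hz.le (sq_nonneg _)).trans h2) (sq_nonneg _)
    have h8 : η * (‖a‖ * ‖x‖) ^ 2 ≤ ‖a‖ * ‖x‖ := by nlinarith
    rw [le_div_iff₀ hz]
    rcases (mul_nonneg (norm_nonneg a) (norm_nonneg x)).eq_or_lt with h9 | h9
    · rw [← h9]; simp
    · nlinarith
  have hA : 0 < 1 + 1 / η ^ 2 := by positivity
  have hstep : ‖s (q + 1)‖ ≤ ‖s q‖ / η := by
    refine norm_le_div_of_mul_sq_le hz ((hT q).trans ?_)
    refine ((neg_le_abs _).trans (Complex.abs_im_le_norm _)).trans ?_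
    rw [norm_mul, Complex.norm_conj]
  have hsq : ‖s q‖ * ‖φ (q + 1)‖ ≤ 1 + 1 / η ^ 2 := by
    have h1 : s q * φ (q + 1) = s (q + 1) * φ q - 1 := by linear_combination -hW q
    rw [← norm_mul, h1]
    refine (norm_sub_le _ _).trans ?_
    rw [norm_mul, norm_one, add_comm]
    gcongr
    calc ‖s (q + 1)‖ * ‖φ q‖ ≤ ‖s q‖ / η * ‖φ q‖ := by gcongr
      _ = ‖s q‖ * ‖φ q‖ / η := by ring
      _ ≤ 1 / η / η := by gcongr; exact hdiag q hq
      _ = 1 / η ^ 2 := by field_simp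
  have htail : ∑' m, ‖s (q + m + 1)‖ ^ 2 ≤ ‖s q‖ ^ 2 / η ^ 2 := by
    rw [(hs.hasSum_tail hz hlim q).tsum_eq]
    have h1 : -(s (q + 1) * conj (s q)).im ≤ ‖s (q + 1)‖ * ‖s q‖ := by
      refine ((neg_le_abs _).trans (Complex.abs_im_le_norm _)).trans ?_
      rw [norm_mul, Complex.norm_conj]
    calc -(s (q + 1) * conj (s q)).im / η ≤ ‖s (q + 1)‖ * ‖s q‖ / η := by gcongr
      _ ≤ ‖s q‖ / η * ‖s q‖ / η := by gcongr
      _ = _ := by field_simp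
  have hΔ := norm_discriminant_le (V := V) hz hq
  calc ‖aeval z (discriminant V q)‖ ^ 2 * ∑' m, ‖s (q + m + 1)‖ ^ 2
      ≤ ((1 + 1 / η ^ 2) * ‖φ (q + 1)‖) ^ 2 * (‖s q‖ ^ 2 / η ^ 2) := by gcongr
    _ = (1 + 1 / η ^ 2) ^ 2 * (‖s q‖ * ‖φ (q + 1)‖) ^ 2 / η ^ 2 := by ring
    _ ≤ (1 + 1 / η ^ 2) ^ 2 * (1 + 1 / η ^ 2) ^ 2 / η ^ 2 := by gcongr
    _ = _ := by ring

end HalfLine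

/-! ### Floquet theory: real simple zeros and critical values of the discriminant -/

namespace HalfLine

open Polynomial ComplexConjugate

variable {V : ℕ → ℝ} {z : ℂ}

/-- The last conjunct serves only to carry the two-step recursion through the induction. -/
theorem dirichlet_monic_degree (V : ℕ → ℝ) (n : ℕ) :
    (solPoly V 0 1 (n + 1)).Monic ∧ (solPoly V 0 1 (n + 1)).degree = (n : WithBot ℕ) ∧
      (solPoly V 0 1 n).degree < (n : WithBot ℕ) := by
  induction n with
  | zero => simp [solPoly]
  | succ n ih =>
    obtain ⟨hm, hd, hl⟩ := ih
    have h1 : ((X - C (V n)) * solPoly V 0 1 (n + 1)).Monic := (monic_X_sub_C _).mul hm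
    have h2 : ((X - C (V n)) * solPoly V 0 1 (n + 1)).degree =
        ((n + 1 : ℕ) : WithBot ℕ) := by
      rw [degree_mul, degree_X_sub_C, hd]; push_cast; ring
    have h3 : (solPoly V 0 1 n).degree < ((X - C (V n)) * solPoly V 0 1 (n + 1)).degree := by
      rw [h2]
      exact hl.trans (by exact_mod_cast Nat.lt_succ_self n)
    refine ⟨h1.sub_of_left h3, ?_, ?_⟩
    · rw [solPoly, degree_sub_eq_left_of_degree_lt h3, h2]
    · rw [hd]; exact_mod_cast Nat.lt_succ_self n

theorem degree_neumann_le (V : ℕ → ℝ) (n : ℕ) :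
    (solPoly V 1 0 (n + 1)).degree ≤ n ∧ (solPoly V 1 0 (n + 2)).degree ≤ n := by
  induction n with
  | zero => simp [solPoly]
  | succ n ih =>
    obtain ⟨h1, h2⟩ := ih
    refine ⟨h2.trans (by exact_mod_cast Nat.le_succ n), ?_⟩
    change ((X - C (V (n + 1))) * solPoly V 1 0 (n + 2) - solPoly V 1 0 (n + 1)).degree ≤ _
    refine (degree_sub_le _ _).trans (max_le ?_ (h1.trans (by exact_mod_cast Nat.le_succ n)))
    rw [degree_mul, degree_X_sub_C]
    push_cast
    rw [add_comm]
    gcongr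

theorem discriminant_monic_degree (V : ℕ → ℝ) {q : ℕ} (hq : 1 ≤ q) :
    (discriminant V q).Monic ∧ (discriminant V q).degree = q := by
  obtain ⟨hm, hd, -⟩ := dirichlet_monic_degree V q
  have hlt : (solPoly V 1 0 q).degree < (solPoly V 0 1 (q + 1)).degree := by
    obtain ⟨p, rfl⟩ := Nat.exists_eq_add_of_le' hq
    rw [hd]
    exact (degree_neumann_le V p).1.trans_lt (by exact_mod_cast Nat.lt_succ_self p)
  exact ⟨hm.add_of_left hlt, by rw [discriminant, degree_add_eq_left_of_degree_lt hlt, hd]⟩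

/-- Quasi-periodic solutions exist at the energies where the discriminant is `μ + μ⁻¹`. -/
theorem exists_bloch {q : ℕ} {μ : ℂ} (hμ : μ ≠ 0)
    (h : aeval z (discriminant V q) = μ + μ⁻¹) :
    ∃ s, IsSol V z s ∧ (s 1 ≠ 0 ∨ s 0 ≠ 0) ∧ s (q + 1) = μ * s 1 ∧ s q = μ * s 0 := by
  rw [aeval_discriminant] at h
  have hdet := transfer_det V z q
  set a := dirichletSol V z (q + 1)
  set b := neumannSol V z (q + 1)
  set c := dirichletSol V z q
  set d := neumannSol V z q
  -- The transfer matrix has determinant `1` and trace `μ + μ⁻¹`, so `μ` is an eigenvalue.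
  have h0 : Matrix.det !![a - μ, b; c, d - μ] = 0 := by
    rw [Matrix.det_fin_two_of]
    have h2 : μ * μ⁻¹ = 1 := mul_inv_cancel₀ hμ
    linear_combination hdet - μ * h - h2
  obtain ⟨v, hv, hv0⟩ := Matrix.exists_mulVec_eq_zero_iff.2 h0
  have e0 := congrFun hv0 0
  have e1 := congrFun hv0 1
  simp [Matrix.mulVec, dotProduct, Fin.sum_univ_two] at e0 e1
  refine ⟨_, (isSol_dirichletSol V z).linearCombination (isSol_neumannSol V z) (v 0) (v 1),
    ?_, ?_, ?_⟩
  · by_contra! hcon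
    simp at hcon
    exact hv (by ext i; fin_cases i <;> simp [hcon])
  · simp only [dirichletSol_one, neumannSol_one]
    linear_combination e0
  · simp only [dirichletSol_zero, neumannSol_zero]
    linear_combination e1

/-- The recursion is required inside one period only, so that an eigenvector of the truncation
extended by one value at each end qualifies. -/
theorem discriminant_eq_of_bloch {q : ℕ} {μ : ℂ} (hμ : μ ≠ 0) {s : ℕ → ℂ}
    (hs : ∀ n < q, s (n + 2) + s n + V n * s (n + 1) = z * s (n + 1))
    (h0 : s 1 ≠ 0 ∨ s 0 ≠ 0) (h1 : s (q + 1) = μ * s 1) (h2 : s q = μ * s 0) :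
    aeval z (discriminant V q) = μ + μ⁻¹ := by
  rw [aeval_discriminant]
  have hdet := transfer_det V z q
  have e0 := eq_combination_of_le hs (q + 1) le_rfl
  have e1 := eq_combination_of_le hs q (Nat.le_succ q)
  rw [h1] at e0
  rw [h2] at e1
  set a := dirichletSol V z (q + 1)
  set b := neumannSol V z (q + 1)
  set c := dirichletSol V z q
  set d := neumannSol V z q
  have hD : (a - μ) * (d - μ) - b * c = 0 := by
    rcases h0 with h0 | h0
    · refine (mul_eq_zero.1 ?_).resolve_left h0
      linear_combination (-(d - μ)) * e0 + b * e1
    · refine (mul_eq_zero.1 ?_).resolve_left h0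
      linear_combination c * e0 - (a - μ) * e1
  have h3 : μ * μ⁻¹ = 1 := mul_inv_cancel₀ hμ
  refine mul_left_cancel₀ hμ ?_
  linear_combination hdet - hD - h3

theorem bloch_ne_zero {q : ℕ} (hq : 1 ≤ q) {μ : ℂ} (hμ : μ ≠ 0) {s : ℕ → ℂ}
    (h0 : s 1 ≠ 0 ∨ s 0 ≠ 0) (h2 : s q = μ * s 0) : ∃ n < q, s (n + 1) ≠ 0 := by
  by_contra! hcon
  obtain ⟨p, rfl⟩ := Nat.exists_eq_add_of_le' hq
  have h3 := hcon p (Nat.lt_succ_self p)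
  rw [h2] at h3
  exact h0.elim (fun h => h (hcon 0 (Nat.succ_pos p)))
    (fun h => h ((mul_eq_zero.1 h3).resolve_left hμ))

/-- A unimodular multiplier makes the flux equal at both ends of a period, so `Im z` times the mass
over the period is zero. -/
theorem im_eq_zero_of_discriminant {q : ℕ} (hq : 1 ≤ q) {μ : ℂ} (hμ : ‖μ‖ = 1)
    (h : aeval z (discriminant V q) = μ + μ⁻¹) : z.im = 0 := by
  have hμ0 : μ ≠ 0 := norm_ne_zero_iff.1 (by rw [hμ]; exact one_ne_zero)
  obtain ⟨s, hs, h0, h1, h2⟩ := exists_bloch hμ0 h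
  have hW := hs.im_mul_conj 0 q
  simp only [zero_add, h1, h2] at hW
  have h3 : μ * s 1 * conj (μ * s 0) = s 1 * conj (s 0) := by
    have : μ * conj μ = 1 := by
      rw [Complex.mul_conj, Complex.normSq_eq_norm_sq, hμ]; simp
    rw [map_mul]
    linear_combination s 1 * conj (s 0) * this
  rw [h3] at hW
  have h4 : z.im * ∑ m ∈ Finset.range q, ‖s (m + 1)‖ ^ 2 = 0 := by linarith
  refine (mul_eq_zero.1 h4).resolve_right (ne_of_gt ?_)
  obtain ⟨n, hn, hne⟩ := bloch_ne_zero hq hμ0 h0 h2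
  exact Finset.sum_pos' (fun _ _ => sq_nonneg _)
    ⟨n, Finset.mem_range.2 hn, pow_pos (norm_pos_iff.2 hne) 2⟩

/-- Maximum principle: at a site where the Bloch solution is largest in modulus over a period,
unimodularity of `μ` ensures that both neighbours, even across the boundary, are no larger. -/
theorem norm_le_of_discriminant {q : ℕ} (hq : 1 ≤ q) {C : ℝ} (hC : ∀ n, |V n| ≤ C) {μ : ℂ}
    (hμ : ‖μ‖ = 1) (h : aeval z (discriminant V q) = μ + μ⁻¹) : ‖z‖ ≤ C + 2 := by
  have hμ0 : μ ≠ 0 := norm_ne_zero_iff.1 (by rw [hμ]; exact one_ne_zero)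
  obtain ⟨s, hs, h0, h1, h2⟩ := exists_bloch hμ0 h
  obtain ⟨m, hm, hmax⟩ := Finset.exists_max_image (Finset.range q) (fun n => ‖s (n + 1)‖)
    ⟨0, Finset.mem_range.2 hq⟩
  rw [Finset.mem_range] at hm
  have hmax' : ∀ n < q, ‖s (n + 1)‖ ≤ ‖s (m + 1)‖ := fun n hn => hmax n (Finset.mem_range.2 hn)
  have hpos : 0 < ‖s (m + 1)‖ := by
    obtain ⟨n, hn, hne⟩ := bloch_ne_zero hq hμ0 h0 h2
    exact (norm_pos_iff.2 hne).trans_le (hmax' n hn)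
  have hr : ‖s (m + 2)‖ ≤ ‖s (m + 1)‖ := by
    rcases Nat.lt_or_ge (m + 1) q with h | h
    · exact hmax' _ h
    · obtain rfl : q = m + 1 := by omega
      rw [h1, norm_mul, hμ, one_mul]
      exact hmax' 0 hq
  have hl : ‖s m‖ ≤ ‖s (m + 1)‖ := by
    rcases m with _ | m
    · have : ‖s q‖ = ‖s 0‖ := by rw [h2, norm_mul, hμ, one_mul]
      rw [← this]
      obtain ⟨p, rfl⟩ := Nat.exists_eq_add_of_le' hq
      exact hmax' p (Nat.lt_succ_self p)
    · exact hmax' m (by omega)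
  have h3 : ‖z‖ * ‖s (m + 1)‖ ≤ (C + 2) * ‖s (m + 1)‖ := by
    rw [← norm_mul, ← hs m]
    refine norm_add₃_le.trans ?_
    have : ‖(V m : ℂ) * s (m + 1)‖ ≤ C * ‖s (m + 1)‖ := by
      rw [norm_mul, Complex.norm_real, Real.norm_eq_abs]
      exact mul_le_mul_of_nonneg_right (hC m) (norm_nonneg _)
    linarith
  exact le_of_mul_le_mul_right h3 hpos

theorem truncation_mulVec (V : ℕ → ℝ) {q : ℕ} (k : ℝ) (ψ : Fin q → ℂ) (s : ℕ → ℂ)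
    (hs : ∀ i : Fin q, s (i + 1) = ψ i)
    (h0 : s 0 = Complex.exp (-(Complex.I * k)) * s q)
    (h1 : s (q + 1) = Complex.exp (Complex.I * k) * s 1) (i : Fin q) :
    (truncation V q k).mulVec ψ i = s (i + 2) + s i + V i * s (i + 1) := by
  have hlast : ∀ (n : ℕ) (c : ℕ → ℂ), (∑ j : Fin q, if (j : ℕ) = n then c j * ψ j else 0) =
      if n < q then c n * s (n + 1) else 0 := by
    intro n c
    split_ifs with hn
    · rw [Finset.sum_eq_single (⟨n, hn⟩ : Fin q)]
      · simp [← hs]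
      · intro j _ hj
        rw [if_neg]
        intro h; exact hj (Fin.ext h)
      · simp
    · refine Finset.sum_eq_zero fun j _ => if_neg ?_
      have := j.2; omega
  have e1 : (∑ j : Fin q, (if i = j then (V i : ℂ) else 0) * ψ j) = V i * s (i + 1) := by
    simp [hs]
  have e2 : (∑ j : Fin q, (if (j : ℕ) = i + 1 then (1 : ℂ) else 0) * ψ j) =
      if (i : ℕ) + 1 < q then s (i + 2) else 0 := by
    have := hlast (i + 1) (fun _ => 1)
    simpa [ite_mul] using this
  have e3 : (∑ j : Fin q, (if (i : ℕ) = j + 1 then (1 : ℂ) else 0) * ψ j) =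
      if 0 < (i : ℕ) then s i else 0 := by
    rcases Nat.eq_zero_or_pos (i : ℕ) with h | h
    · rw [if_neg (by omega)]
      refine Finset.sum_eq_zero fun j _ => ?_
      rw [if_neg (by omega), zero_mul]
    · rw [if_pos h]
      have := hlast (i - 1) (fun _ => 1)
      rw [if_pos (by omega), show (i : ℕ) - 1 + 1 = i by omega, one_mul] at this
      rw [← this]
      refine Finset.sum_congr rfl fun j _ => ?_
      have hiff : (i : ℕ) = j + 1 ↔ (j : ℕ) = i - 1 := by omega
      simp [ite_mul, hiff]
  have e4 : (∑ j : Fin q, (if (i : ℕ) = 0 ∧ (j : ℕ) + 1 = q then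
      Complex.exp (-(Complex.I * (k : ℂ))) else 0) * ψ j) = if (i : ℕ) = 0 then s 0 else 0 := by
    split_ifs with h
    · have := hlast (q - 1) (fun _ => Complex.exp (-(Complex.I * (k : ℂ))))
      have hi := i.2
      rw [if_pos (by omega), show q - 1 + 1 = q by omega, ← h0] at this
      rw [← this]
      refine Finset.sum_congr rfl fun j _ => ?_
      have hiff : ((i : ℕ) = 0 ∧ (j : ℕ) + 1 = q) ↔ (j : ℕ) = q - 1 := by omega
      simp [ite_mul, hiff]
    · refine Finset.sum_eq_zero fun j _ => ?_
      rw [if_neg (by tauto), zero_mul]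
  have e5 : (∑ j : Fin q, (if (i : ℕ) + 1 = q ∧ (j : ℕ) = 0 then
      Complex.exp (Complex.I * (k : ℂ)) else 0) * ψ j) =
      if (i : ℕ) + 1 = q then s (q + 1) else 0 := by
    split_ifs with h
    · have := hlast 0 (fun _ => Complex.exp (Complex.I * (k : ℂ)))
      rw [if_pos (by omega), zero_add, ← h1] at this
      rw [← this]
      refine Finset.sum_congr rfl fun j _ => ?_
      simp [ite_mul, h]
    · refine Finset.sum_eq_zero fun j _ => ?_
      rw [if_neg (by tauto), zero_mul]
  simp only [truncation, Matrix.mulVec, dotProduct, Matrix.of_apply, add_mul,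
    Finset.sum_add_distrib]
  rw [e1, e2, e3, e4, e5]
  have hi := i.2
  have f1 : (if (i : ℕ) + 1 < q then s (i + 2) else 0) +
      (if (i : ℕ) + 1 = q then s (q + 1) else 0) = s (i + 2) := by
    rcases Nat.lt_or_ge ((i : ℕ) + 1) q with h | h
    · rw [if_pos h, if_neg (by omega), add_zero]
    · have h' : (i : ℕ) + 1 = q := by omega
      rw [if_neg (by omega), if_pos h', zero_add, show (i : ℕ) + 2 = q + 1 by omega]
  have f2 : (if 0 < (i : ℕ) then s i else 0) + (if (i : ℕ) = 0 then s 0 else 0) = s i := by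
    rcases Nat.eq_zero_or_pos (i : ℕ) with h | h
    · simp [h]
    · simp [h, h.ne']
  linear_combination f1 + f2

/-- Eigenvectors of the truncation are the Bloch solutions with multiplier `e^{ik}`, restricted to
one period. -/
theorem hasEigenvalue_truncation_iff {q : ℕ} (hq : 1 ≤ q) (k : ℝ) :
    Module.End.HasEigenvalue (Matrix.toLin' (truncation V q k)) z ↔
      aeval z (discriminant V q) =
        Complex.exp (Complex.I * k) + (Complex.exp (Complex.I * k))⁻¹ := by
  set μ := Complex.exp (Complex.I * k) with hμdef
  have hμ : μ ≠ 0 := Complex.exp_ne_zero _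
  have hμinv : Complex.exp (-(Complex.I * k)) = μ⁻¹ := Complex.exp_neg _
  constructor
  · intro h
    obtain ⟨ψ, hψ⟩ := h.exists_hasEigenvector
    have hψ0 := hψ.2
    have hψe : (truncation V q k).mulVec ψ = z • ψ := by
      rw [← Matrix.toLin'_apply]; exact hψ.apply_eq_smul
    obtain ⟨p, rfl⟩ := Nat.exists_eq_add_of_le' hq
    -- The last branch is read only at `n = p + 2`, the site just to the right of the box.
    let s : ℕ → ℂ := fun n => if n = 0 then μ⁻¹ * ψ (Fin.last p) else
      if h : n - 1 < p + 1 then ψ ⟨n - 1, h⟩ else μ * ψ 0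
    have hs : ∀ i : Fin (p + 1), s (i + 1) = ψ i := fun i => by
      simp only [s]
      rw [if_neg (by omega), dif_pos (by simpa using i.is_le)]
      rfl
    have hlast : s (p + 1) = ψ (Fin.last p) := hs (Fin.last p)
    have hone : s 1 = ψ 0 := hs 0
    have h0 : s 0 = μ⁻¹ * s (p + 1) := by rw [hlast]; simp [s]
    have h1 : s (p + 1 + 1) = μ * s 1 := by rw [hone]; simp [s]
    have hrec := truncation_mulVec V k ψ s hs (by rw [hμinv, h0]) h1
    refine discriminant_eq_of_bloch hμ (s := s) (fun n hn => ?_) ?_ h1 ?_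
    · have h2 := hrec ⟨n, hn⟩
      rw [hψe] at h2
      simp only [Pi.smul_apply, smul_eq_mul] at h2
      rw [← hs ⟨n, hn⟩] at h2
      exact h2.symm
    · by_contra! hcon
      refine hψ0 (funext fun i => ?_)
      have h3 := eq_combination_of_le (V := V) (z := z) (s := s) (q := p + 1) (fun n hn => by
        have h2 := hrec ⟨n, hn⟩
        rw [hψe] at h2
        simp only [Pi.smul_apply, smul_eq_mul] at h2
        rw [← hs ⟨n, hn⟩] at h2
        exact h2.symm) (i + 1) (by omega)
      rw [hs, hcon.1, hcon.2] at h3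
      simpa using h3
    · rw [h0, mul_inv_cancel_left₀ hμ]
  · intro h
    obtain ⟨s, hs, h0, h1, h2⟩ := exists_bloch hμ h
    refine Module.End.hasEigenvalue_of_hasEigenvector (x := fun i : Fin q => s (i + 1)) ?_
    refine ⟨Module.End.mem_eigenspace_iff.2 ?_, ?_⟩
    · ext i
      rw [Matrix.toLin'_apply, truncation_mulVec V k _ s (fun _ => rfl)
        (by rw [hμinv, h2, inv_mul_cancel_left₀ hμ]) h1 i]
      exact hs i
    · obtain ⟨n, hn, hne⟩ := bloch_ne_zero hq hμ h0 h2
      intro hcon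
      exact hne (congrFun hcon ⟨n, hn⟩)

theorem aeval_ofReal (p : ℝ[X]) (x : ℝ) : aeval (x : ℂ) p = ((p.eval x : ℝ) : ℂ) := by
  rw [← Complex.coe_algebraMap, aeval_algebraMap_apply_eq_algebraMap_eval, Complex.coe_algebraMap]

/-- At `k = π/2` the multiplier is `i`, and `i + i⁻¹ = 0`. -/
theorem eigenvalueSet_eq {q : ℕ} (hq : 1 ≤ q) :
    eigenvalueSet V q = {E | (discriminant V q).IsRoot E} := by
  ext E
  have h : Complex.exp (Complex.I * ((Real.pi / 2 : ℝ) : ℂ)) = Complex.I := by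
    rw [mul_comm]; push_cast; exact Complex.exp_pi_div_two_mul_I
  simp only [eigenvalueSet, Set.mem_ofPred_eq]
  rw [hasEigenvalue_truncation_iff hq, h, Complex.inv_I, add_neg_cancel, aeval_ofReal,
    Complex.ofReal_eq_zero]
  rfl

theorem exists_phase {t : ℝ} (ht : |t| ≤ 2) : ∃ μ : ℂ, ‖μ‖ = 1 ∧ μ + μ⁻¹ = t := by
  obtain ⟨h1, h2⟩ := abs_le.1 ht
  refine ⟨Complex.exp (Real.arccos (t / 2) * Complex.I), Complex.norm_exp_ofReal_mul_I _, ?_⟩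
  rw [← Complex.exp_neg, ← neg_mul, ← Complex.two_cos, ← Complex.ofReal_cos,
    Real.cos_arccos (by linarith) (by linarith)]
  push_cast; ring

/-- For `t = 2 cos θ` every complex root carries a Bloch solution with unimodular multiplier, hence
is real. The value `t = 0` gives the zeros themselves; `t = ±2` enter the bound on critical values.
-/
theorem splits_discriminant_sub {q : ℕ} (hq : 1 ≤ q) {t : ℝ} (ht : |t| ≤ 2) :
    (discriminant V q - C t).Splits := by
  refine Splits.of_splits_map (algebraMap ℝ ℂ) (IsAlgClosed.splits _) fun z hz => ?_
  have hz' : aeval z (discriminant V q - C t) = 0 := by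
    have := (mem_roots'.1 hz).2
    rwa [IsRoot, eval_map_algebraMap] at this
  obtain ⟨μ, hμ, hμt⟩ := exists_phase ht
  have him : z.im = 0 := by
    refine im_eq_zero_of_discriminant (V := V) hq hμ ?_
    rw [hμt]
    simpa [sub_eq_zero] using hz'
  exact ⟨z.re, by apply Complex.ext <;> simp [him]⟩

theorem abs_root_le {q : ℕ} (hq : 1 ≤ q) {C : ℝ} (hC : ∀ n, |V n| ≤ C) {E : ℝ}
    (hE : (discriminant V q).IsRoot E) : |E| ≤ C + 2 := by
  have h := norm_le_of_discriminant (V := V) (z := E) hq hC (μ := Complex.I) (by simp)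
    (by rw [aeval_ofReal, hE.eq_zero]; simp)
  simpa using h

/-- Strict Laguerre inequality for real-rooted polynomials. -/
theorem laguerre_multiset (m : Multiset ℝ) (x : ℝ) :
    let p := (m.map fun a => X - C a).prod
    p.eval x * p.derivative.derivative.eval x ≤ p.derivative.eval x ^ 2 ∧
      (m ≠ 0 → p.eval x ≠ 0 →
        p.eval x * p.derivative.derivative.eval x < p.derivative.eval x ^ 2) := by
  induction m using Multiset.induction_on with
  | empty => simp
  | cons a m ih =>
    simp only [Multiset.map_cons, Multiset.prod_cons]
    set r := (m.map fun a => X - C a).prod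
    have e : ((X - C a) * r).derivative.derivative.eval x =
        2 * r.derivative.eval x + (x - a) * r.derivative.derivative.eval x := by
      simp [derivative_mul]; ring
    have e1 : ((X - C a) * r).derivative.eval x = r.eval x + (x - a) * r.derivative.eval x := by
      simp [derivative_mul]
    have e0 : ((X - C a) * r).eval x = (x - a) * r.eval x := by simp
    have key : ((X - C a) * r).derivative.eval x ^ 2 -
        ((X - C a) * r).eval x * ((X - C a) * r).derivative.derivative.eval x =
        r.eval x ^ 2 + (x - a) ^ 2 *
          (r.derivative.eval x ^ 2 - r.eval x * r.derivative.derivative.eval x) := by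
      rw [e, e1, e0]; ring
    have h1 : 0 ≤ (x - a) ^ 2 *
          (r.derivative.eval x ^ 2 - r.eval x * r.derivative.derivative.eval x) :=
      mul_nonneg (sq_nonneg _) (sub_nonneg.2 ih.1)
    refine ⟨by nlinarith [sq_nonneg (r.eval x)], fun _ hp => ?_⟩
    have h2 : 0 < r.eval x ^ 2 := by
      have : r.eval x ≠ 0 := fun h => hp (by rw [e0, h, mul_zero])
      positivity
    linarith

theorem laguerre {p : ℝ[X]} (hp : p.Splits) (hm : p.Monic) (hd : p.natDegree ≠ 0) {x : ℝ}
    (hx : p.eval x ≠ 0) :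
    p.eval x * p.derivative.derivative.eval x < p.derivative.eval x ^ 2 := by
  have h := (laguerre_multiset p.roots x).2
  rw [← hp.eq_prod_roots_of_monic hm] at h
  refine h (fun h0 => hd ?_) hx
  rw [hp.natDegree_eq_card_roots, h0, Multiset.card_zero]

/-- If `|Δ(c)| < 2`, then `Δ - 2` and `Δ + 2` have opposite signs at `c`. Both are real-rooted, and
the strict Laguerre inequality at a critical point makes each have sign opposite to `Δ''(c)`, which
is impossible. -/
theorem two_le_abs_discriminant {q : ℕ} (hq : 1 ≤ q) {c : ℝ}
    (hc : (discriminant V q).derivative.IsRoot c) : 2 ≤ |(discriminant V q).eval c| := by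
  obtain ⟨hm, hd⟩ := discriminant_monic_degree V hq
  set p := discriminant V q
  by_contra! hlt
  have key : ∀ t : ℝ, |t| ≤ 2 → t ≠ p.eval c →
      (p.eval c - t) * p.derivative.derivative.eval c < 0 := by
    intro t ht hne
    have hdeg : (C t).degree < p.degree := by
      rw [hd]
      exact degree_C_le.trans_lt (by exact_mod_cast hq)
    have hnd : (p - C t).natDegree ≠ 0 := by
      rw [natDegree_sub_C, natDegree_eq_of_degree_eq_some hd]; omega
    have h := laguerre (splits_discriminant_sub (V := V) hq ht) (hm.sub_of_left hdeg) hnd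
      (x := c) (by rw [eval_sub, eval_C]; exact sub_ne_zero.2 hne.symm)
    have hc' : p.derivative.eval c = 0 := hc
    rw [derivative_sub, derivative_C, sub_zero, hc', eval_sub, eval_C] at h
    simpa using h
  obtain ⟨h1, h2⟩ := abs_lt.1 hlt
  have a1 := key 2 (by norm_num) (by linarith)
  have a2 := key (-2) (by norm_num) (by linarith)
  nlinarith

/-- A multiple zero would be a critical point with critical value `0`. -/
theorem nodup_roots_discriminant {q : ℕ} (hq : 1 ≤ q) : (discriminant V q).roots.Nodup := by
  obtain ⟨hm, hd⟩ := discriminant_monic_degree V hq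
  rw [Multiset.nodup_iff_count_le_one]
  intro a
  rw [count_roots]
  by_contra! h
  have hroot := one_lt_rootMultiplicity_iff_isRoot (hm.ne_zero) |>.1 h
  have h2 := two_le_abs_discriminant hq hroot.2
  rw [hroot.1.eq_zero] at h2
  norm_num at h2

/-- The discriminant is the product over its (simple, real) zeros. -/
theorem discriminant_eq_prod {q : ℕ} (hq : 1 ≤ q) :
    discriminant V q = ∏ E ∈ (discriminant V q).roots.toFinset, (X - C E) ∧
      (discriminant V q).roots.toFinset.card = q := by
  obtain ⟨hm, hd⟩ := discriminant_monic_degree V hq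
  have hs : (discriminant V q).Splits := by
    simpa using splits_discriminant_sub (V := V) hq (t := 0) (by norm_num)
  have hn := nodup_roots_discriminant (V := V) hq
  constructor
  · conv_lhs => rw [hs.eq_prod_roots_of_monic hm]
    rw [Finset.prod, Multiset.toFinset_val, hn.dedup]
  · rw [Multiset.toFinset_card_of_nodup hn, ← hs.natDegree_eq_card_roots,
      natDegree_eq_of_degree_eq_some hd]

end HalfLine

/-! ### Clusters of zeros force a large discriminant above the real axis -/

namespace HalfLine

open Polynomial

/-- Interpolating between two distances `a`, `b` gains over the weighted geometric mean when the
nearer distance `a` is small compared to the imaginary part `η`. -/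
theorem log_gain {a b τ s η ε : ℝ} (ha : 0 < a) (hb : 0 < b) (hτ : 0 ≤ τ) (hτ' : τ ≤ 1 / 2)
    (hs : (1 - τ) * a + τ * b ≤ s) (hη : 0 < η) (hηs : η ≤ s) (hε : a ≤ ε) :
    (1 - τ) * Real.log a + τ * Real.log b + 1 / 2 * Real.log (η / (2 * ε)) ≤ Real.log s := by
  have hs0 : 0 < s := hη.trans_le hηs
  -- Concavity is used with the doubled weight `2τ`, admissible since `τ ≤ 1/2`. The weighted
  -- logarithm in the claim is half of this one plus `(log a) / 2`; the spare half is estimated by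
  -- `a ≤ ε`, while half of `log s` is kept back for `η ≤ s`.
  have hconc : (1 - 2 * τ) * Real.log a + 2 * τ * Real.log b ≤
      Real.log ((1 - 2 * τ) * a + 2 * τ * b) := by
    have := strictConcaveOn_log_Ioi.concaveOn.2 (Set.mem_Ioi.2 ha) (Set.mem_Ioi.2 hb)
      (by linarith : 0 ≤ 1 - 2 * τ) (by linarith : 0 ≤ 2 * τ) (by ring)
    simpa using this
  have hpos : 0 < (1 - 2 * τ) * a + 2 * τ * b := by
    rcases hτ.eq_or_lt with h | h
    · rw [← h]; simpa using ha
    · have : 0 < 2 * τ * b := by positivity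
      have : 0 ≤ (1 - 2 * τ) * a := mul_nonneg (by linarith) ha.le
      linarith
  have h1 : Real.log ((1 - 2 * τ) * a + 2 * τ * b) ≤ Real.log (2 * s) :=
    Real.log_le_log hpos (by nlinarith)
  have h2 : Real.log η ≤ Real.log s := Real.log_le_log hη hηs
  have h3 : Real.log a ≤ Real.log ε := Real.log_le_log ha hε
  have hε0 : ε ≠ 0 := (ha.trans_le hε).ne'
  rw [Real.log_div hη.ne' (by positivity), Real.log_mul two_ne_zero hε0]
  rw [Real.log_mul two_ne_zero hs0.ne'] at h1
  linarith

theorem log_mean_le {a b τ s : ℝ} (ha : 0 < a) (hb : 0 < b) (hτ : 0 ≤ τ) (hτ' : τ ≤ 1)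
    (hs : (1 - τ) * a + τ * b ≤ s) :
    (1 - τ) * Real.log a + τ * Real.log b ≤ Real.log s := by
  have h := strictConcaveOn_log_Ioi.concaveOn.2 (Set.mem_Ioi.2 ha) (Set.mem_Ioi.2 hb)
    (by linarith : 0 ≤ 1 - τ) hτ (by ring)
  simp only [smul_eq_mul] at h
  refine h.trans (Real.log_le_log ?_ hs)
  have := (convex_Ioi (0 : ℝ)) (Set.mem_Ioi.2 ha) (Set.mem_Ioi.2 hb)
    (by linarith : 0 ≤ 1 - τ) hτ (by ring)
  simpa using this

/-- Lower bound for a product of complex distances from a point `x + iη`, by interpolation between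
two real points `c`, `c'` where the product of distances is at least `1`. -/
theorem sum_log_lower {S B G : Finset ℝ} {N : ℝ → ℝ} {c c' τ η ε D : ℝ}
    (hη : 0 < η) (hN : ∀ E ∈ S, η ≤ N E)
    (hc : ∀ E ∈ S, c ≠ E) (hc' : ∀ E ∈ S, c' ≠ E)
    (h1 : 0 ≤ ∑ E ∈ S, Real.log |c - E|) (h1' : 0 ≤ ∑ E ∈ S, Real.log |c' - E|)
    (hτ : 0 ≤ τ) (hτ' : τ ≤ 1 / 2) (hBS : B ⊆ S) (hGS : G ⊆ S) (hGB : Disjoint G B)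
    (hgood : ∀ E ∈ S, E ∉ B → (1 - τ) * |c - E| + τ * |c' - E| ≤ N E)
    (hD : ∀ E ∈ S, |c - E| ≤ D) (hD' : ∀ E ∈ S, |c' - E| ≤ D)
    (hG : ∀ E ∈ G, |c - E| ≤ ε) :
    G.card * (1 / 2 * Real.log (η / (2 * ε))) - B.card * Real.log (D / η) ≤
      ∑ E ∈ S, Real.log (N E) := by
  have hpt : ∀ E ∈ S, (1 - τ) * Real.log |c - E| + τ * Real.log |c' - E| +
      ((if E ∈ G then 1 / 2 * Real.log (η / (2 * ε)) else 0) -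
        if E ∈ B then Real.log (D / η) else 0) ≤ Real.log (N E) := by
    intro E hE
    have ha : 0 < |c - E| := abs_pos.2 (sub_ne_zero.2 (hc E hE))
    have hb : 0 < |c' - E| := abs_pos.2 (sub_ne_zero.2 (hc' E hE))
    by_cases hEB : E ∈ B
    · have hEG : E ∉ G := fun h => Finset.disjoint_left.1 hGB h hEB
      rw [if_pos hEB, if_neg hEG]
      -- For the exceptional points interpolation is unavailable: both real distances are at most
      -- `D` and the complex one is at least `η`, so each costs at most `log (D / η)`.
      have hD0 : 0 < D := ha.trans_le (hD E hE)
      have h2 := Real.log_le_log ha (hD E hE)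
      have h3 := Real.log_le_log hb (hD' E hE)
      have h4 := Real.log_le_log hη (hN E hE)
      rw [Real.log_div hD0.ne' hη.ne']
      nlinarith
    · rw [if_neg hEB]
      by_cases hEG : E ∈ G
      · rw [if_pos hEG]
        have := log_gain ha hb hτ hτ' (hgood E hE hEB) hη (hN E hE) (hG E hEG)
        linarith
      · rw [if_neg hEG]
        have := log_mean_le ha hb hτ (by linarith) (hgood E hE hEB)
        linarith
  have hsum := Finset.sum_le_sum hpt
  rw [Finset.sum_add_distrib, Finset.sum_add_distrib, Finset.sum_sub_distrib, ← Finset.mul_sum,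
    ← Finset.mul_sum, Finset.sum_ite_mem, Finset.sum_ite_mem, Finset.inter_eq_right.2 hBS,
    Finset.inter_eq_right.2 hGS, Finset.sum_const, Finset.sum_const, nsmul_eq_mul,
    nsmul_eq_mul] at hsum
  have h2 : 0 ≤ (1 - τ) * ∑ E ∈ S, Real.log |c - E| := mul_nonneg (by linarith) h1
  have h3 : 0 ≤ τ * ∑ E ∈ S, Real.log |c' - E| := mul_nonneg hτ h1'
  linarith

/-- A cover of `S` by intervals of length at most `ε`, each containing at least `m` points of `S`. -/
structure ClusterCover (S : Finset ℝ) (ε m : ℝ) where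
  /-- the index set -/
  ι : Type
  /-- left end points -/
  a : ι → ℝ
  /-- right end points -/
  b : ι → ℝ
  len_le : ∀ j, b j - a j ≤ ε
  cover : ∀ E ∈ S, ∃ j, E ∈ Set.Icc (a j) (b j)
  card_ge : ∀ j, m ≤ ((S.filter fun E => E ∈ Set.Icc (a j) (b j)).card : ℝ)

/-- In a region without marked points that separate neighbours inside a cluster there are at most
two points of `S`. -/
theorem ClusterCover.card_le_two {S : Finset ℝ} {ε m : ℝ} (K : ClusterCover S ε m) (hm : 1 < m)
    {Good : Set ℝ}
    (hG : ∀ j, ∀ E₁ ∈ S, ∀ E₂ ∈ S, E₁ ∈ Set.Icc (K.a j) (K.b j) → E₂ ∈ Set.Icc (K.a j) (K.b j) →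
      E₁ < E₂ → ∃ c ∈ Good, E₁ < c ∧ c < E₂)
    {O : Set ℝ} (hO : O.OrdConnected) (hGO : ∀ c ∈ Good, c ∉ O) [DecidablePred (· ∈ O)] :
    (S.filter (· ∈ O)).card ≤ 2 := by
  by_contra! hcard
  -- no two points of `S ∩ O` lie in the same cluster
  have hsep : ∀ E₁ ∈ S, ∀ E₂ ∈ S, E₁ ∈ O → E₂ ∈ O → ∀ j, E₁ ∈ Set.Icc (K.a j) (K.b j) →
      E₂ ∈ Set.Icc (K.a j) (K.b j) → ¬ E₁ < E₂ := by
    intro E₁ h1 E₂ h2 o1 o2 j j1 j2 hlt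
    obtain ⟨c, hc, hc1, hc2⟩ := hG j E₁ h1 E₂ h2 j1 j2 hlt
    exact hGO c hc (hO.out o1 o2 ⟨hc1.le, hc2.le⟩)
  -- A middle point among three has a companion in its cluster. On the companion's side, whichever
  -- of the companion and the outer point is closer lies both in `O` and in that cluster,
  -- contradicting `hsep`.
  have hmid : ∀ E₁ ∈ S, ∀ E₂ ∈ S, ∀ E₃ ∈ S, E₁ ∈ O → E₃ ∈ O → E₁ < E₂ → E₂ < E₃ → False := by
    intro E₁ h1 E₂ h2 E₃ h3 o1 o3 h12 h23
    have o2 : E₂ ∈ O := hO.out o1 o3 ⟨h12.le, h23.le⟩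
    obtain ⟨j, hj⟩ := K.cover E₂ h2
    have hlt : 1 < (S.filter fun E => E ∈ Set.Icc (K.a j) (K.b j)).card := by
      exact_mod_cast hm.trans_le (K.card_ge j)
    obtain ⟨E', hE', hne⟩ := Finset.exists_mem_ne hlt E₂
    rw [Finset.mem_filter] at hE'
    rcases lt_or_gt_of_ne hne with h | h
    · rcases le_or_gt E₁ E' with h' | h'
      · exact hsep E' hE'.1 E₂ h2 (hO.out o1 o2 ⟨h', h.le⟩) o2 j hE'.2 hj h
      · exact hsep E₁ h1 E₂ h2 o1 o2 j ⟨hE'.2.1.trans h'.le, h12.le.trans hj.2⟩ hj h12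
    · rcases le_or_gt E' E₃ with h' | h'
      · exact hsep E₂ h2 E' hE'.1 o2 (hO.out o2 o3 ⟨h.le, h'⟩) j hj hE'.2 h
      · exact hsep E₂ h2 E₃ h3 o2 o3 j hj ⟨hj.1.trans h23.le, h'.le.trans hE'.2.2⟩ h23
  obtain ⟨x, y, w, hx, hy, hw, hxy, hxw, hyw⟩ := Finset.two_lt_card_iff.1 hcard
  simp only [Finset.mem_filter] at hx hy hw
  rcases lt_or_gt_of_ne hxy with h1 | h1 <;> rcases lt_or_gt_of_ne hxw with h2 | h2 <;>
    rcases lt_or_gt_of_ne hyw with h3 | h3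
  · exact hmid x hx.1 y hy.1 w hw.1 hx.2 hw.2 h1 h3
  · exact hmid x hx.1 w hw.1 y hy.1 hx.2 hy.2 h2 h3
  · linarith
  · exact hmid w hw.1 x hx.1 y hy.1 hw.2 hy.2 h2 h1
  · exact hmid y hy.1 x hx.1 w hw.1 hy.2 hw.2 h1 h2
  · linarith
  · exact hmid y hy.1 w hw.1 x hx.1 hy.2 hx.2 h3 h2
  · exact hmid w hw.1 y hy.1 x hx.1 hw.2 hx.2 h3 h1

/-- One-sided form of the cluster bound: `c` is a marked point in a cluster and `c'` any marked
point, and `x` lies between them (weakly), nearer to `c`. -/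
theorem ClusterCover.lower_of_near {S : Finset ℝ} {ε m : ℝ} (K : ClusterCover S ε m)
    {x η D c c' τ : ℝ} {O : Set ℝ} [DecidablePred (· ∈ O)]
    (hη : 0 < η) (hηε : 2 * ε ≤ η) (hε : 0 < ε) (hηD : η ≤ D)
    (hc : ∀ E ∈ S, c ≠ E) (hc' : ∀ E ∈ S, c' ≠ E)
    (h1 : 0 ≤ ∑ E ∈ S, Real.log |c - E|) (h1' : 0 ≤ ∑ E ∈ S, Real.log |c' - E|)
    (hD : ∀ E ∈ S, |c - E| ≤ D) (hD' : ∀ E ∈ S, |c' - E| ≤ D)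
    (hcj : ∃ j, c ∈ Set.Icc (K.a j) (K.b j))
    (hτ : 0 ≤ τ) (hτ' : τ ≤ 1 / 2) (hcard : (S.filter (· ∈ O)).card ≤ 2)
    (hgood : ∀ E ∈ S, E ∉ O → (1 - τ) * |c - E| + τ * |c' - E| ≤ |x - E|) :
    (m - 2) * (1 / 2 * Real.log (η / (2 * ε))) - 2 * Real.log (D / η) ≤
      ∑ E ∈ S, Real.log ‖((x : ℂ) + η * Complex.I) - E‖ := by
  obtain ⟨j, hj⟩ := hcj
  set B := S.filter (· ∈ O) with hB
  set T := S.filter fun E => E ∈ Set.Icc (K.a j) (K.b j) with hT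
  have hre : ∀ E : ℝ, ((x : ℂ) + η * Complex.I - E).re = x - E := fun E => by simp
  have him : ∀ E : ℝ, ((x : ℂ) + η * Complex.I - E).im = η := fun E => by simp
  have hgain : 0 ≤ 1 / 2 * Real.log (η / (2 * ε)) :=
    mul_nonneg (by norm_num) (Real.log_nonneg ((one_le_div (by positivity)).2 hηε))
  have hloss : 0 ≤ Real.log (D / η) := Real.log_nonneg ((one_le_div hη).2 hηD)
  have hcardG : m - 2 ≤ ((T \ B).card : ℝ) := by
    have h2 : T.card ≤ (T \ B).card + B.card := Finset.card_le_card_sdiff_add_card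
    have h3 := K.card_ge j
    have h4 : (T.card : ℝ) ≤ (T \ B).card + 2 := by exact_mod_cast h2.trans (by omega)
    simp only [← hT] at h3
    linarith
  refine le_trans ?_ (sum_log_lower (B := B) (G := T \ B)
    (N := fun E => ‖((x : ℂ) + η * Complex.I) - E‖) hη ?_ hc hc' h1 h1' hτ hτ'
    (Finset.filter_subset _ _) (Finset.sdiff_subset.trans (Finset.filter_subset _ _))
    Finset.sdiff_disjoint ?_ hD hD' (ε := ε) ?_)
  · have h2 : (B.card : ℝ) ≤ 2 := by exact_mod_cast hcard
    have h3 := mul_le_mul_of_nonneg_right hcardG hgain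
    have h4 := mul_le_mul_of_nonneg_right h2 hloss
    linarith
  · intro E _
    have := Complex.abs_im_le_norm ((x : ℂ) + η * Complex.I - E)
    rw [him] at this
    exact (le_abs_self _).trans this
  · intro E hE hEB
    have h2 := Complex.abs_re_le_norm ((x : ℂ) + η * Complex.I - E)
    rw [hre] at h2
    refine (hgood E hE fun hEO => hEB ?_).trans h2
    exact Finset.mem_filter.2 ⟨hE, hEO⟩
  · intro E hE
    have hE' := (Finset.mem_filter.1 (Finset.mem_sdiff.1 hE).1).2
    have h2 := K.len_le j
    rw [abs_le]
    constructor <;> linarith [hE'.1, hE'.2, hj.1, hj.2]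

/-- Bracket `x` by the nearest marked points. For `E` outside the bracket, `|x - E|` is exactly the
interpolation of the distances from its ends, and the gain comes from the cluster of the nearer end.
Beyond all marked points, the extreme one plays both roles with weight `0`. -/
theorem ClusterCover.lower {S : Finset ℝ} {ε m : ℝ} (K : ClusterCover S ε m) (hm : 1 < m)
    (hS : S.Nonempty) {Good : Finset ℝ}
    (hG : ∀ j, ∀ E₁ ∈ S, ∀ E₂ ∈ S, E₁ ∈ Set.Icc (K.a j) (K.b j) → E₂ ∈ Set.Icc (K.a j) (K.b j) →
      E₁ < E₂ → ∃ c ∈ Good, E₁ < c ∧ c < E₂)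
    (hGK : ∀ c ∈ Good, ∃ j, c ∈ Set.Icc (K.a j) (K.b j))
    (hGS : ∀ c ∈ Good, ∀ E ∈ S, c ≠ E)
    (hG1 : ∀ c ∈ Good, 0 ≤ ∑ E ∈ S, Real.log |c - E|)
    {D : ℝ} (hD : ∀ c ∈ Good, ∀ E ∈ S, |c - E| ≤ D)
    {η : ℝ} (hη : 0 < η) (hηε : 2 * ε ≤ η) (hε : 0 < ε) (hηD : η ≤ D) (x : ℝ) :
    (m - 2) * (1 / 2 * Real.log (η / (2 * ε))) - 2 * Real.log (D / η) ≤
      ∑ E ∈ S, Real.log ‖((x : ℂ) + η * Complex.I) - E‖ := by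
  classical
  have hne : Good.Nonempty := by
    obtain ⟨E, hE⟩ := hS
    obtain ⟨j, hj⟩ := K.cover E hE
    have hlt : 1 < (S.filter fun E => E ∈ Set.Icc (K.a j) (K.b j)).card := by
      exact_mod_cast hm.trans_le (K.card_ge j)
    obtain ⟨E', hE', hne⟩ := Finset.exists_mem_ne hlt E
    rw [Finset.mem_filter] at hE'
    rcases lt_or_gt_of_ne hne with h | h
    · obtain ⟨c, hc, -⟩ := hG j E' hE'.1 E hE hE'.2 hj h
      exact ⟨c, hc⟩
    · obtain ⟨c, hc, -⟩ := hG j E hE E' hE'.1 hj hE'.2 h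
      exact ⟨c, hc⟩
  have hG' : ∀ j, ∀ E₁ ∈ S, ∀ E₂ ∈ S, E₁ ∈ Set.Icc (K.a j) (K.b j) →
      E₂ ∈ Set.Icc (K.a j) (K.b j) → E₁ < E₂ → ∃ c ∈ (Good : Set ℝ), E₁ < c ∧ c < E₂ := hG
  by_cases hl : ∃ c ∈ Good, c ≤ x
  · by_cases hr : ∃ c ∈ Good, x ≤ c
    · obtain ⟨c, hc, hcmax⟩ := (Good.filter (· ≤ x)).exists_max_image id
        (let ⟨c, h1, h2⟩ := hl; ⟨c, Finset.mem_filter.2 ⟨h1, h2⟩⟩)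
      obtain ⟨c', hc', hcmin⟩ := (Good.filter (x ≤ ·)).exists_min_image id
        (let ⟨c, h1, h2⟩ := hr; ⟨c, Finset.mem_filter.2 ⟨h1, h2⟩⟩)
      rw [Finset.mem_filter] at hc hc'
      obtain ⟨hcG, hcx⟩ := hc
      obtain ⟨hcG', hcx'⟩ := hc'
      have hcard : (S.filter (· ∈ Set.Ioo c c')).card ≤ 2 := by
        refine K.card_le_two hm hG' Set.ordConnected_Ioo fun y hy hyO => ?_
        rcases le_total y x with h | h
        · exact absurd (hcmax y (Finset.mem_filter.2 ⟨hy, h⟩)) (not_le.2 hyO.1)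
        · exact absurd (hcmin y (Finset.mem_filter.2 ⟨hy, h⟩)) (not_le.2 hyO.2)
      have habs : ∀ σ, 0 ≤ σ → σ ≤ 1 → x = (1 - σ) * c + σ * c' → ∀ E, E ∉ Set.Ioo c c' →
          (1 - σ) * |c - E| + σ * |c' - E| ≤ |x - E| := by
        intro σ h0 h1 hx E hE
        rcases le_or_gt E c with h | h
        · rw [abs_of_nonneg (by linarith), abs_of_nonneg (by linarith),
            abs_of_nonneg (by linarith), hx]
          linarith
        · have h' : c' ≤ E := not_lt.1 fun h'' => hE ⟨h, h''⟩
          rw [abs_of_nonpos (by linarith), abs_of_nonpos (by linarith),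
            abs_of_nonpos (by linarith), hx]
          linarith
      obtain ⟨σ, h0, h1, hx⟩ : ∃ σ : ℝ, 0 ≤ σ ∧ σ ≤ 1 ∧ x = (1 - σ) * c + σ * c' := by
        rcases (hcx.trans hcx').eq_or_lt with h | h
        · exact ⟨0, le_rfl, zero_le_one, by linarith⟩
        · refine ⟨(x - c) / (c' - c), div_nonneg (by linarith) (by linarith),
            (div_le_one (by linarith)).2 (by linarith), ?_⟩
          have : c' - c ≠ 0 := by linarith
          field_simp
          ring
      rcases le_or_gt σ (1 / 2) with hσ | hσ
      · exact K.lower_of_near hη hηε hε hηD (hGS c hcG) (hGS c' hcG') (hG1 c hcG) (hG1 c' hcG')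
          (hD c hcG) (hD c' hcG') (hGK c hcG) h0 hσ hcard fun E _ hE => habs σ h0 h1 hx E hE
      -- Here `x` is nearer to `c'`, so the ends are exchanged to keep the weight at most `1/2`.
      · refine K.lower_of_near hη hηε hε hηD (hGS c' hcG') (hGS c hcG) (hG1 c' hcG') (hG1 c hcG)
          (hD c' hcG') (hD c hcG) (hGK c' hcG') (τ := 1 - σ) (by linarith) (by linarith) hcard
          fun E _ hE => ?_
        have := habs σ h0 h1 hx E hE
        linarith
    · push Not at hr
      obtain ⟨c, hcG, hcmax⟩ := Good.exists_max_image id hne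
      have hcard : (S.filter (· ∈ Set.Ioi c)).card ≤ 2 :=
        K.card_le_two hm hG' Set.ordConnected_Ioi fun y hy hyO =>
          absurd (hcmax y hy) (not_le.2 hyO)
      refine K.lower_of_near hη hηε hε hηD (hGS c hcG) (hGS c hcG) (hG1 c hcG) (hG1 c hcG)
        (hD c hcG) (hD c hcG) (hGK c hcG) le_rfl (by norm_num) hcard fun E _ hE => ?_
      have hE' : E ≤ c := not_lt.1 hE
      have := hr c hcG
      rw [abs_of_nonneg (by linarith), abs_of_nonneg (by linarith)]
      linarith
  · push Not at hl
    obtain ⟨c, hcG, hcmin⟩ := Good.exists_min_image id hne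
    have hcard : (S.filter (· ∈ Set.Iio c)).card ≤ 2 :=
      K.card_le_two hm hG' Set.ordConnected_Iio fun y hy hyO =>
        absurd (hcmin y hy) (not_le.2 hyO)
    refine K.lower_of_near hη hηε hε hηD (hGS c hcG) (hGS c hcG) (hG1 c hcG) (hG1 c hcG)
      (hD c hcG) (hD c hcG) (hGK c hcG) le_rfl (by norm_num) hcard fun E _ hE => ?_
    have hE' : c ≤ E := not_lt.1 hE
    have := hl c hcG
    rw [abs_of_nonpos (by linarith), abs_of_nonpos (by linarith)]
    linarith

variable {V : ℕ → ℝ}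

theorem norm_aeval_discriminant {q : ℕ} (hq : 1 ≤ q) (z : ℂ) :
    ‖aeval z (discriminant V q)‖ = ∏ E ∈ (discriminant V q).roots.toFinset, ‖z - E‖ := by
  conv_lhs => rw [(discriminant_eq_prod hq).1]
  rw [map_prod, norm_prod]
  simp

/-- If the spectrum of a periodic approximation is clustered, its discriminant is large along the
line `Im z = η` above the real axis. -/
theorem log_discriminant_lower {q : ℕ} (hq : 1 < q) {C : ℝ} (hC : ∀ n, |V n| ≤ C) {ε ξ : ℝ}
    (hξ : 0 < ξ) (hε : 0 < ε) (hcl : IsClustered (eigenvalueSet V q) q ε ξ)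
    {η : ℝ} (hη : 0 < η) (hηε : 2 * ε ≤ η) (hη1 : η ≤ 1) (x : ℝ) :
    ((q : ℝ) ^ ξ - 2) * (1 / 2 * Real.log (η / (2 * ε))) - 2 * Real.log ((2 * C + 5) / η) ≤
      Real.log ‖aeval ((x : ℂ) + η * Complex.I) (discriminant V q)‖ := by
  classical
  have hq1 : 1 ≤ q := hq.le
  have hC0 : 0 ≤ C := (abs_nonneg _).trans (hC 0)
  obtain ⟨hmon, hdeg⟩ := discriminant_monic_degree V hq1
  obtain ⟨hprod, hScard⟩ := discriminant_eq_prod (V := V) hq1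
  set p := discriminant V q with hp
  set S := p.roots.toFinset with hSdef
  have hmem : ∀ E, E ∈ S ↔ p.IsRoot E := fun E => by
    rw [hSdef, Multiset.mem_toFinset, mem_roots hmon.ne_zero]
  have hSe : eigenvalueSet V q = (S : Set ℝ) := by
    rw [eigenvalueSet_eq hq1]; ext E; simp [hmem]; rfl
  obtain ⟨k, a, b, -, hlen, -, hcov, hcard⟩ := hcl
  let K : ClusterCover S ε ((q : ℝ) ^ ξ) :=
    { ι := Fin k
      a := a
      b := b
      len_le := fun j => (hlen j).2
      cover := fun E hE => by
        have : E ∈ eigenvalueSet V q := by rw [hSe]; exact hE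
        simpa using hcov this
      card_ge := fun j => by
        refine (hcard j).trans_eq ?_
        rw [hSe, ← Set.ncard_coe_finset]
        congr 2
        ext E; simp }
  have hm : 1 < (q : ℝ) ^ ξ := Real.one_lt_rpow (by exact_mod_cast hq) hξ
  -- The marked points are the critical points inside the cluster intervals: Rolle provides one
  -- between any two zeros of a cluster, and `|Δ| ≥ 2` there makes the sum of logarithms
  -- nonnegative.
  let Good : Finset ℝ :=
    p.derivative.roots.toFinset.filter fun c => ∃ j, c ∈ Set.Icc (K.a j) (K.b j)
  have hd0 : p.derivative ≠ 0 := by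
    intro h
    have h2 := derivative_eq_zero.1 h
    rw [natDegree_eq_of_degree_eq_some hdeg] at h2
    omega
  have hcrit : ∀ c ∈ Good, 2 ≤ |p.eval c| := fun c hc => by
    have := (Finset.mem_filter.1 hc).1
    rw [Multiset.mem_toFinset, mem_roots hd0] at this
    exact two_le_abs_discriminant hq1 this
  have hGS : ∀ c ∈ Good, ∀ E ∈ S, c ≠ E := fun c hc E hE h => by
    have h2 := hcrit c hc
    rw [h, ((hmem E).1 hE).eq_zero] at h2
    norm_num at h2
  have habs : ∀ c ∈ Good, ∀ E ∈ S, |c - E| ≤ 2 * C + 5 := by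
    -- Zeros have modulus at most `C + 2`, and `c` is within `ε ≤ 1/2` of one; this is where `2C +
    -- 5` comes from.
    intro c hc E hE
    obtain ⟨j, hj⟩ := (Finset.mem_filter.1 hc).2
    have h1 : 0 < (S.filter fun E => E ∈ Set.Icc (K.a j) (K.b j)).card := by
      exact_mod_cast (zero_lt_one.trans hm).trans_le (K.card_ge j)
    obtain ⟨E', hE'⟩ := Finset.card_pos.1 h1
    rw [Finset.mem_filter] at hE'
    have h2 := abs_root_le hq1 hC ((hmem E).1 hE)
    have h3 := abs_root_le hq1 hC ((hmem E').1 hE'.1)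
    have h4 := K.len_le j
    rw [abs_le] at *
    constructor <;> linarith [hj.1, hj.2, hE'.2.1, hE'.2.2, h2.1, h2.2, h3.1, h3.2]
  have key := K.lower hm (Finset.card_pos.1 (by omega)) (Good := Good) ?_
    (fun c hc => (Finset.mem_filter.1 hc).2) hGS ?_ habs hη hηε hε (by linarith) x
  · rw [norm_aeval_discriminant hq1, Real.log_prod]
    · exact key
    · intro E _ h
      have := congrArg Complex.im (norm_eq_zero.1 h)
      simp at this
      exact hη.ne' this
  · intro j E₁ h1 E₂ h2 j1 j2 hlt
    obtain ⟨c, hc, hder⟩ := exists_hasDerivAt_eq_zero hlt p.continuous.continuousOn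
      (by rw [((hmem E₁).1 h1).eq_zero, ((hmem E₂).1 h2).eq_zero])
      (fun y _ => p.hasDerivAt y)
    refine ⟨c, Finset.mem_filter.2 ⟨?_, j, j1.1.trans hc.1.le, hc.2.le.trans j2.2⟩, hc.1, hc.2⟩
    rw [Multiset.mem_toFinset, mem_roots hd0]
    exact hder
  · intro c hc
    rw [← Real.log_prod (fun E hE => abs_ne_zero.2 (sub_ne_zero.2 (hGS c hc E hE)))]
    refine Real.log_nonneg ?_
    rw [← Finset.abs_prod]
    have : p.eval c = ∏ E ∈ S, (c - E) := by
      conv_lhs => rw [hprod]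
      rw [eval_prod]; simp
    rw [← this]
    linarith [hcrit c hc]

/-- Quadratic growth of the discriminant along a line above the real axis. -/
theorem discriminant_quadratic_lower {q : ℕ} (hq : 1 < q) {C : ℝ} (hC : ∀ n, |V n| ≤ C)
    {η R : ℝ} (hR : R ≤ 2 ^ q)
    (hM : ∀ x : ℝ, R ≤ ‖aeval ((x : ℂ) + η * Complex.I) (discriminant V q)‖) (hR0 : 0 ≤ R)
    (x : ℝ) :
    R * (1 + x ^ 2) / (32 * (C + 3) ^ 2) ≤
      ‖aeval ((x : ℂ) + η * Complex.I) (discriminant V q)‖ := by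
  have hC0 : 0 ≤ C := (abs_nonneg _).trans (hC 0)
  have hpos : 0 < 32 * (C + 3) ^ 2 := by positivity
  rw [div_le_iff₀ hpos]
  -- Beyond this threshold every factor is at least `|x| / 2 ≥ 2`: two factors supply the quadratic
  -- growth, and the other `q - 2` supply `2^(q-2)`, which the hypothesis `R ≤ 2^q` compares with
  -- `R`.
  rcases le_or_gt |x| (2 * (C + 2) + 2) with hx | hx
  · have h1 : x ^ 2 ≤ (2 * (C + 2) + 2) ^ 2 := sq_le_sq' (abs_le.1 hx).1 (abs_le.1 hx).2
    have h2 : 1 + x ^ 2 ≤ 32 * (C + 3) ^ 2 := by nlinarith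
    calc R * (1 + x ^ 2) ≤ R * (32 * (C + 3) ^ 2) := by gcongr
      _ ≤ _ := by gcongr; exact hM x
  · have hfac : ∀ E ∈ (discriminant V q).roots.toFinset,
        |x| / 2 ≤ ‖(x : ℂ) + η * Complex.I - E‖ := by
      intro E hE
      rw [Multiset.mem_toFinset] at hE
      have h1 := abs_root_le hq.le hC (mem_roots'.1 hE).2
      have h2 := Complex.abs_re_le_norm ((x : ℂ) + η * Complex.I - E)
      have h3 : |x| - |E| ≤ |x - E| := abs_sub_abs_le_abs_sub x E
      simp only [Complex.sub_re, Complex.add_re, Complex.ofReal_re, Complex.mul_re, Complex.I_re,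
        mul_zero, Complex.ofReal_im, Complex.I_im, zero_mul, sub_zero, add_zero] at h2
      linarith
    have h1 : (|x| / 2) ^ q ≤ ‖aeval ((x : ℂ) + η * Complex.I) (discriminant V q)‖ := by
      rw [norm_aeval_discriminant hq.le]
      have := Finset.prod_le_prod (s := (discriminant V q).roots.toFinset)
        (fun _ _ => by positivity) hfac
      rwa [Finset.prod_const, (discriminant_eq_prod hq.le).2] at this
    obtain ⟨p, rfl⟩ := Nat.exists_eq_add_of_le' (hq : 2 ≤ q)
    have h2 : (2 : ℝ) ^ p * (|x| / 2) ^ 2 ≤ (|x| / 2) ^ (p + 2) := by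
      rw [pow_add]
      gcongr
      linarith
    have h3 : (|x| / 2) ^ 2 = x ^ 2 / 4 := by rw [div_pow, sq_abs]; norm_num
    have h4 : 1 ≤ x ^ 2 := by
      rw [← sq_abs]; nlinarith
    have h5 : (2 : ℝ) ^ (p + 2) = 4 * 2 ^ p := by ring
    have h6 : (0 : ℝ) < 2 ^ p := by positivity
    have h7 : R * (1 + x ^ 2) ≤ 4 * 2 ^ p * (2 * x ^ 2) := by
      rw [← h5]
      exact mul_le_mul hR (by linarith) (by positivity) (by positivity)
    have h8 : 2 ^ p * (x ^ 2 / 4) ≤ ‖aeval ((x : ℂ) + η * Complex.I) (discriminant V (p + 2))‖ := by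
      rw [← h3]; exact h2.trans h1
    have h9 : (32 : ℝ) ≤ 32 * (C + 3) ^ 2 := by nlinarith
    calc R * (1 + x ^ 2) ≤ 2 ^ p * (x ^ 2 / 4) * 32 := by linarith
      _ ≤ _ := by gcongr

end HalfLine

/-! ### From the resolvent to the time-averaged wave packet -/

namespace HalfLine

open Polynomial ComplexConjugate

variable (V : ℕ → ℝ) (hV : ∃ C : ℝ, ∀ n, |V n| ≤ C)

theorem tendsto_coord_zero (ψ : Space) : Tendsto (fun n => ψ n) atTop (𝓝 0) := by
  have h := (hasSum_sq ψ).summable.tendsto_atTop_zero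
  rw [tendsto_zero_iff_norm_tendsto_zero]
  have h2 := (Real.continuous_sqrt.tendsto _).comp h
  simpa [Function.comp_def, Real.sqrt_sq (norm_nonneg _)] using h2

/-- Partial sums of the difference of the two inner products telescope to a Wronskian at the right
end, which tends to zero because coordinates of `ℓ²` vectors do. -/
theorem isSelfAdjoint_hamiltonian : IsSelfAdjoint (hamiltonian V hV) := by
  rw [ContinuousLinearMap.isSelfAdjoint_iff_isSymmetric]
  intro x y
  simp only [ContinuousLinearMap.coe_coe]
  have h1 := lp.hasSum_inner (𝕜 := ℂ) (hamiltonian V hV x) y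
  have h2 := lp.hasSum_inner (𝕜 := ℂ) x (hamiltonian V hV y)
  have h3 := (h1.sub h2).tendsto_sum_nat
  have hpart : ∀ N, ∑ n ∈ Finset.range (N + 1), (inner ℂ (hamiltonian V hV x n) (y n) -
      inner ℂ (x n) (hamiltonian V hV y n)) =
      conj (x (N + 1)) * y N - conj (x N) * y (N + 1) := by
    intro N
    induction N with
    | zero => simp [hamiltonian_apply, leftNbr]; ring
    | succ N ih =>
      rw [Finset.sum_range_succ, ih]
      simp [hamiltonian_apply, leftNbr]; ring
  have h4 : Tendsto (fun N => conj (x (N + 1)) * y N - conj (x N) * y (N + 1)) atTop (𝓝 0) := by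
    have hc : ∀ ψ : Space, Tendsto (fun n => conj (ψ n)) atTop (𝓝 0) := fun ψ => by
      have h := (Complex.continuous_conj.tendsto 0).comp (tendsto_coord_zero ψ)
      rwa [map_zero] at h
    have hx := hc x
    have hy := tendsto_coord_zero y
    have h := (((tendsto_add_atTop_iff_nat 1).2 hx).mul hy).sub
      (hx.mul ((tendsto_add_atTop_iff_nat 1).2 hy))
    simpa only [mul_zero, sub_zero] using h
  have h5 := (tendsto_add_atTop_iff_nat 1).2 h3
  simp only [hpart] at h5
  exact sub_eq_zero.1 (tendsto_nhds_unique h5 h4)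

/-- The wave packet started at the first site. -/
noncomputable def wave (t : ℝ) : Space := evolution V hV t (delta 0)

theorem norm_delta (n : ℕ) : ‖delta n‖ = 1 := by
  rw [delta, lp.norm_single]
  · simp
  · norm_num

theorem norm_wave (t : ℝ) : ‖wave V hV t‖ = 1 := by
  have hmem : evolution V hV t ∈ unitary (Space →L[ℂ] Space) := by
    have hsa : IsSelfAdjoint (((-t : ℝ) : ℂ) • hamiltonian V hV) :=
      IsSelfAdjoint.smul (Complex.conj_ofReal (-t)) (isSelfAdjoint_hamiltonian V hV)
    have h := (selfAdjoint.expUnitary ⟨((-t : ℝ) : ℂ) • hamiltonian V hV,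
      selfAdjoint.mem_iff.2 hsa.star_eq⟩).2
    rw [selfAdjoint.expUnitary_coe] at h
    convert h using 1
    rw [evolution, smul_smul]
    congr 2
    push_cast; ring
  rw [wave, ContinuousLinearMap.norm_map_of_mem_unitary hmem, norm_delta]

theorem wave_zero : wave V hV 0 = delta 0 := by simp [wave, evolution]

theorem hasDerivAt_wave (t : ℝ) :
    HasDerivAt (wave V hV) (-(Complex.I • hamiltonian V hV (wave V hV t))) t := by
  have h1 := hasDerivAt_exp_smul_const' (𝕂 := ℂ) (-(Complex.I • hamiltonian V hV)) (t : ℂ)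
  have h2 := h1.scomp t Complex.ofRealCLM.hasDerivAt
  have h3 : (fun s : ℂ => NormedSpace.exp (s • -(Complex.I • hamiltonian V hV))) ∘
      Complex.ofReal =
      evolution V hV := by
    funext s
    rw [Function.comp_apply, evolution, smul_neg, smul_smul, neg_smul,
      mul_comm]
  rw [h3] at h2
  have h4 := (ContinuousLinearMap.apply ℂ Space (delta 0)).restrictScalars ℝ |>.hasFDerivAt
    |>.comp_hasDerivAt t h2
  refine h4.congr_deriv ?_
  have h5 : NormedSpace.exp ((t : ℂ) • -(Complex.I • hamiltonian V hV)) = evolution V hV t :=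
    congrFun h3 t
  rw [h5]
  simp [wave]

theorem continuous_wave : Continuous (wave V hV) :=
  continuous_iff_continuousAt.2 fun t => (hasDerivAt_wave V hV t).continuousAt

theorem norm_exp_I_mul (z : ℂ) (t : ℝ) :
    ‖Complex.exp (Complex.I * z * t)‖ = Real.exp (-z.im * t) := by
  rw [Complex.norm_exp]; simp

theorem continuous_exp_I_mul (z : ℂ) : Continuous fun t : ℝ => Complex.exp (Complex.I * z * t) := by
  fun_prop

theorem integrableOn_exp_smul_wave {z : ℂ} (hz : 0 < z.im) :
    IntegrableOn (fun t : ℝ => Complex.exp (Complex.I * z * t) • wave V hV t) (Set.Ioi 0) := by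
  refine Integrable.mono' (integrableOn_exp_mul_Ioi (neg_lt_zero.2 hz) 0)
    ((continuous_exp_I_mul z).smul (continuous_wave V hV)).aestronglyMeasurable ?_
  filter_upwards with t
  rw [norm_smul, norm_wave, mul_one, norm_exp_I_mul]

/-- The resolvent applied to the first unit vector, as a Laplace transform of the wave packet. -/
noncomputable def resolventVec (z : ℂ) : Space :=
  Complex.I • ∫ t in Set.Ioi (0 : ℝ), Complex.exp (Complex.I * z * t) • wave V hV t

/-- The integrand has derivative `i(z - H)` applied to itself, equals `δ₁` at time `0` and tends to
`0`, so the fundamental theorem of calculus gives the equation. -/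
theorem hamiltonian_resolventVec {z : ℂ} (hz : 0 < z.im) :
    hamiltonian V hV (resolventVec V hV z) = z • resolventVec V hV z + delta 0 := by
  set H := hamiltonian V hV
  let A : Space →L[ℂ] Space := (Complex.I * z) • ContinuousLinearMap.id ℂ Space - Complex.I • H
  have hint := integrableOn_exp_smul_wave V hV hz
  have hderiv : ∀ t ∈ Set.Ici (0 : ℝ), HasDerivAt
      (fun t : ℝ => Complex.exp (Complex.I * z * t) • wave V hV t)
      (A (Complex.exp (Complex.I * z * t) • wave V hV t)) t := by
    intro t _
    have h1 : HasDerivAt (fun t : ℝ => Complex.exp (Complex.I * z * t))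
        (Complex.exp (Complex.I * z * t) * (Complex.I * z)) t := by
      have h := ((hasDerivAt_id (t : ℂ)).const_mul (Complex.I * z)).cexp.comp_ofReal
      simpa using h
    refine (h1.smul (hasDerivAt_wave V hV t)).congr_deriv ?_
    simp only [A, sub_apply, smul_apply,
      ContinuousLinearMap.id_apply, map_smul, smul_neg, H]
    module
  have hlim : Tendsto (fun t : ℝ => Complex.exp (Complex.I * z * t) • wave V hV t) atTop (𝓝 0) := by
    rw [tendsto_zero_iff_norm_tendsto_zero]
    simp only [norm_smul, norm_wave, mul_one, norm_exp_I_mul]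
    exact Real.tendsto_exp_atBot.comp (tendsto_id.const_mul_atTop_of_neg (neg_lt_zero.2 hz))
  have h := integral_Ioi_of_hasDerivAt_of_tendsto' hderiv (A.integrable_comp hint) hlim
  rw [A.integral_comp_comm hint] at h
  simp only [Complex.ofReal_zero, mul_zero, Complex.exp_zero, one_smul, wave_zero, zero_sub] at h
  have h2 : A (∫ t in Set.Ioi (0 : ℝ), Complex.exp (Complex.I * z * t) • wave V hV t) =
      z • resolventVec V hV z - H (resolventVec V hV z) := by
    simp only [A, resolventVec, sub_apply, smul_apply,
      ContinuousLinearMap.id_apply, map_smul]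
    module
  rw [h2] at h
  have h3 : H (resolventVec V hV z) =
      z • resolventVec V hV z - (z • resolventVec V hV z - H (resolventVec V hV z)) := by abel
  rw [h3, h, sub_neg_eq_add]

/-- The restriction of a vector to the sites `> q`. -/
noncomputable def tailProj (q : ℕ) : Space →L[ℂ] Space :=
  LinearMap.mkContinuous
    { toFun := fun ψ => ⟨fun n => if q ≤ n then ψ n else 0, (lp.memℓp ψ).mono' fun n => by
        split_ifs <;> simp⟩
      map_add' := fun ψ φ => by
        ext n
        change (if q ≤ n then (ψ + φ) n else 0) =
          (if q ≤ n then ψ n else 0) + if q ≤ n then φ n else 0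
        split_ifs <;> simp
      map_smul' := fun c ψ => by
        ext n
        change (if q ≤ n then (c • ψ) n else 0) = c • if q ≤ n then ψ n else 0
        split_ifs <;> simp }
    1 (fun ψ => by
      rw [one_mul]
      refine lp.norm_mono (by norm_num) fun n => ?_
      change ‖if q ≤ n then ψ n else 0‖ ≤ _
      split_ifs <;> simp)

theorem tailProj_apply (q : ℕ) (ψ : Space) (n : ℕ) :
    tailProj q ψ n = if q ≤ n then ψ n else 0 := rfl

theorem norm_tailProj_le (q : ℕ) (ψ : Space) : ‖tailProj q ψ‖ ≤ ‖ψ‖ := by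
  refine lp.norm_mono (by norm_num) fun n => ?_
  rw [tailProj_apply]
  split_ifs <;> simp

theorem norm_sq_tailProj (q : ℕ) (ψ : Space) : ‖tailProj q ψ‖ ^ 2 = ∑' m, ‖ψ (q + m)‖ ^ 2 := by
  have h := hasSum_sq (tailProj q ψ)
  rw [← h.tsum_eq, ← h.summable.sum_add_tsum_nat_add q, Finset.sum_eq_zero, zero_add]
  · refine tsum_congr fun m => ?_
    rw [tailProj_apply, if_pos (Nat.le_add_left _ _), add_comm]
  · intro n hn
    rw [tailProj_apply, if_neg (not_le.2 (Finset.mem_range.1 hn))]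
    simp

theorem norm_tailProj_resolventVec {z : ℂ} (hz : 0 < z.im) {q : ℕ} (hq : 1 ≤ q) :
    ‖aeval z (discriminant V q)‖ * ‖tailProj q (resolventVec V hV z)‖ ≤
      (1 + 1 / z.im ^ 2) ^ 2 / z.im := by
  set u := resolventVec V hV z
  -- The value `-1` at site `0` absorbs the source `δ₁`, so the inhomogeneous equation for `u`
  -- becomes the homogeneous one.
  let s : ℕ → ℂ := fun n => match n with
    | 0 => -1
    | n + 1 => u n
  have hs : IsSol V z s := by
    intro n
    have h := congrArg (fun ψ : Space => ψ n) (hamiltonian_resolventVec V hV hz)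
    simp only [hamiltonian_apply] at h
    rw [lp.coeFn_add, lp.coeFn_smul, Pi.add_apply, Pi.smul_apply, smul_eq_mul] at h
    rcases n with _ | n
    · simp only [leftNbr, delta, lp.single_apply_self] at h
      change u 1 + -1 + V 0 * u 0 = z * u 0
      linear_combination h
    · have hd : delta 0 (n + 1) = 0 := by
        rw [delta, lp.single_apply_ne _ _ _ (Nat.succ_ne_zero n)]
      rw [hd] at h
      simp only [leftNbr] at h
      change u (n + 2) + u n + V (n + 1) * u (n + 1) = z * u (n + 1)
      linear_combination h
  have hlim : Tendsto s atTop (𝓝 0) := (tendsto_add_atTop_iff_nat 1).1 (tendsto_coord_zero u)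
  have h := hs.tail_le hz hlim rfl hq
  have h2 : ∑' m, ‖s (q + m + 1)‖ ^ 2 = ‖tailProj q u‖ ^ 2 := (norm_sq_tailProj q u).symm
  rw [h2] at h
  refine le_of_sq_le_sq ?_ (by positivity)
  calc _ = ‖aeval z (discriminant V q)‖ ^ 2 * ‖tailProj q u‖ ^ 2 := by ring
    _ ≤ _ := h
    _ = _ := by ring

/-- Fourier inversion along the line `Im z = η` bounds the part of the wave packet outside
`{1, …, q}`. -/
theorem norm_tailProj_wave_le {q : ℕ} (hq : 1 ≤ q) {η B : ℝ} (hη : 0 < η)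
    (hB : ∀ x : ℝ, ‖tailProj q (resolventVec V hV ((x : ℂ) + η * Complex.I))‖ ≤ B / (1 + x ^ 2))
    {t : ℝ} (ht : 0 ≤ t) :
    ‖tailProj q (wave V hV t)‖ ≤ Real.pi * B * Real.exp (η * t) := by
  have hB0 : 0 ≤ B := by
    have := (norm_nonneg _).trans (hB 0)
    simpa using this
  let g : ℝ → Space := fun t => (Real.exp (-η * t) : ℂ) • tailProj q (wave V hV t)
  -- Extension by zero to negative times, written with `max` so that continuity is visible. It
  -- equals zero there because `q ≥ 1` and the packet starts at the first site. Continuity lets the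
  -- inversion formula hold at every time.
  let f : ℝ → Space := fun t => g (max t 0)
  have hg0 : g 0 = 0 := by
    simp only [g, wave_zero]
    ext n
    simp only [mul_zero, Real.exp_zero, Complex.ofReal_one, one_smul, tailProj_apply]
    split_ifs with h
    · rw [delta, lp.single_apply_ne _ _ _ (by omega : n ≠ 0)]; rfl
    · rfl
  have hgc : Continuous g := by
    have h1 : Continuous fun t : ℝ => (Real.exp (-η * t) : ℂ) := by fun_prop
    exact h1.smul ((tailProj q).continuous.comp (continuous_wave V hV))
  have hfc : Continuous f := hgc.comp (continuous_id.max continuous_const)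
  have hf0 : ∀ t, t ∉ Set.Ioi (0 : ℝ) → f t = 0 := fun t ht => by
    simp only [f]; rw [max_eq_right (not_lt.1 ht), hg0]
  have hfg : ∀ t ∈ Set.Ioi (0 : ℝ), f t = g t := fun t ht => by
    simp only [f]; rw [max_eq_left (le_of_lt ht)]
  have hgn : ∀ t, ‖g t‖ ≤ Real.exp (-η * t) := fun t => by
    simp only [g]
    rw [norm_smul, Complex.norm_real, Real.norm_of_nonneg (Real.exp_pos _).le]
    exact mul_le_of_le_one_right (Real.exp_pos _).le
      ((norm_tailProj_le q _).trans_eq (norm_wave V hV t))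
  have hgi : IntegrableOn g (Set.Ioi 0) :=
    Integrable.mono' (integrableOn_exp_mul_Ioi (neg_lt_zero.2 hη) 0) hgc.aestronglyMeasurable
      (Filter.Eventually.of_forall hgn)
  have hfi : Integrable f := by
    have h1 : IntegrableOn f (Set.Ioi 0) := hgi.congr_fun (fun t ht => (hfg t ht).symm)
      measurableSet_Ioi
    exact (integrableOn_iff_integrable_of_support_subset fun t ht => by
      by_contra hcon; exact ht (hf0 t hcon)).1 h1
  have hFT : ∀ w : ℝ, FourierTransform.fourier f w = -(Complex.I • tailProj q
      (resolventVec V hV (((-2 * Real.pi * w : ℝ) : ℂ) + η * Complex.I))) := by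
    intro w
    set z : ℂ := ((-2 * Real.pi * w : ℝ) : ℂ) + η * Complex.I
    have hz : 0 < z.im := by simpa [z] using hη
    rw [Real.fourier_real_eq_integral_exp_smul,
      ← setIntegral_eq_integral_of_forall_compl_eq_zero (s := Set.Ioi (0 : ℝ))
        (fun t ht => by rw [hf0 t ht, smul_zero])]
    have h1 : ∀ t ∈ Set.Ioi (0 : ℝ),
        Complex.exp ((↑(-2 * Real.pi * t * w) : ℂ) * Complex.I) • f t =
          tailProj q (Complex.exp (Complex.I * z * t) • wave V hV t) := by
      intro t ht
      rw [hfg t ht]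
      simp only [g]
      rw [smul_smul, Complex.ofReal_exp, ← Complex.exp_add, map_smul]
      congr 2
      simp only [z]
      push_cast
      linear_combination (-(η : ℂ) * t) * Complex.I_sq
    refine (setIntegral_congr_fun measurableSet_Ioi h1).trans ?_
    rw [(tailProj q).integral_comp_comm (integrableOn_exp_smul_wave V hV hz), resolventVec, map_smul,
      smul_smul, Complex.I_mul_I, neg_one_smul, neg_neg]
  have hFn : ∀ w : ℝ, ‖FourierTransform.fourier f w‖ ≤ B * (1 + w ^ 2)⁻¹ := by
    intro w
    rw [hFT, norm_neg, norm_smul, Complex.norm_I, one_mul]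
    refine (hB _).trans ?_
    rw [div_eq_mul_inv]
    have h1 : 1 ≤ (2 * Real.pi) ^ 2 := one_le_pow₀ (by linarith [Real.pi_gt_three])
    have h2 : w ^ 2 ≤ (-2 * Real.pi * w) ^ 2 := by
      calc w ^ 2 ≤ (2 * Real.pi) ^ 2 * w ^ 2 := le_mul_of_one_le_left (sq_nonneg w) h1
        _ = _ := by ring
    gcongr
  have hFc : Continuous (FourierTransform.fourier f) :=
    VectorFourier.fourierIntegral_continuous Real.continuous_fourierChar
      (innerSL ℝ).continuous₂ hfi
  have hdom : Integrable fun w : ℝ => B * (1 + w ^ 2)⁻¹ := integrable_inv_one_add_sq.const_mul B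
  have hFi : Integrable (FourierTransform.fourier f) :=
    hdom.mono' hFc.aestronglyMeasurable (Filter.Eventually.of_forall hFn)
  have hinv := congrFun (hfc.fourierInv_fourier_eq hfi hFi) t
  have hft : ‖f t‖ ≤ Real.pi * B := by
    rw [← hinv, Real.fourierInv_eq]
    calc _ ≤ ∫ w : ℝ, B * (1 + w ^ 2)⁻¹ := by
          refine norm_integral_le_of_norm_le hdom (Filter.Eventually.of_forall fun w => ?_)
          rw [Circle.norm_smul]
          exact hFn w
      _ = Real.pi * B := by rw [integral_const_mul, integral_univ_inv_one_add_sq, mul_comm]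
  have hft' : ‖f t‖ = Real.exp (-η * t) * ‖tailProj q (wave V hV t)‖ := by
    simp only [f, g]
    rw [max_eq_left ht, norm_smul, Complex.norm_real, Real.norm_of_nonneg (Real.exp_pos _).le]
  rw [hft'] at hft
  calc ‖tailProj q (wave V hV t)‖
      = Real.exp (η * t) * (Real.exp (-η * t) * ‖tailProj q (wave V hV t)‖) := by
        rw [← mul_assoc, ← Real.exp_add]; simp
    _ ≤ Real.exp (η * t) * (Real.pi * B) := by gcongr
    _ = _ := by ring

theorem inner_delta (n : ℕ) (ψ : Space) : inner ℂ (delta n) ψ = ψ n := by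
  rw [delta, lp.inner_single_left]; simp

/-- With `η = 1/(2T)` the squared growth `e^{2ηt} = e^{t/T}` is beaten by the weight `e^{-2t/T}`;
the remaining integral is `T`, which cancels the prefactor `2/T` up to the `2`. -/
theorem outsideProb_le {q : ℕ} (hq : 1 ≤ q) {r T B : ℝ} (hqr : (q : ℝ) ≤ r) (hT : 0 < T)
    (hB : ∀ x : ℝ, ‖tailProj q (resolventVec V hV ((x : ℂ) + (1 / (2 * T) : ℝ) * Complex.I))‖ ≤
      B / (1 + x ^ 2)) :
    outsideProb V hV r T ≤ ENNReal.ofReal (2 * (Real.pi * B) ^ 2) := by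
  have hcoord : ∀ n, Continuous fun t => ‖inner ℂ (delta n) (evolution V hV t (delta 0))‖ ^ 2 *
      Real.exp (-2 * t / T) := by
    intro n
    have h1 : Continuous fun t => inner ℂ (delta n) (wave V hV t) :=
      continuous_const.inner (continuous_wave V hV)
    have h2 : Continuous fun t : ℝ => Real.exp (-2 * t / T) := by fun_prop
    exact (h1.norm.pow 2).mul h2
  rw [outsideProb, ENNReal.tsum_mul_left, ← lintegral_tsum
    (fun n : {n : ℕ // r < (n : ℝ) + 1} => (hcoord n).aemeasurable.ennreal_ofReal)]
  have hpt : ∀ t ∈ Set.Ioi (0 : ℝ), ∑' n : {n : ℕ // r < (n : ℝ) + 1},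
      ENNReal.ofReal (‖inner ℂ (delta n) (evolution V hV t (delta 0))‖ ^ 2 *
        Real.exp (-2 * t / T)) ≤ ENNReal.ofReal ((Real.pi * B) ^ 2 * Real.exp (-(1 / T) * t)) := by
    intro t ht
    have h0 := norm_tailProj_wave_le V hV hq (by positivity : 0 < 1 / (2 * T)) hB (le_of_lt ht)
    set ψ := wave V hV t
    have h1 : ∑' n : {n : ℕ // r < (n : ℝ) + 1},
        ENNReal.ofReal (‖inner ℂ (delta n) (evolution V hV t (delta 0))‖ ^ 2 *
          Real.exp (-2 * t / T)) ≤
        ∑' n : ℕ, ENNReal.ofReal (‖tailProj q ψ n‖ ^ 2 * Real.exp (-2 * t / T)) := by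
      refine le_trans (le_of_eq (tsum_congr fun n => ?_)) (ENNReal.tsum_comp_le_tsum_of_injective
        (Subtype.val_injective (p := fun n : ℕ => r < (n : ℝ) + 1)) _)
      have hqn : q ≤ n.1 := by
        have : (q : ℝ) < (n.1 : ℝ) + 1 := hqr.trans_lt n.2
        exact Nat.lt_succ_iff.1 (by exact_mod_cast this)
      rw [inner_delta, tailProj_apply, if_pos hqn]
      rfl
    refine h1.trans ?_
    have hs := (hasSum_sq (tailProj q ψ)).mul_right (Real.exp (-2 * t / T))
    rw [← ENNReal.ofReal_tsum_of_nonneg (fun n => by positivity) hs.summable, hs.tsum_eq]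
    refine ENNReal.ofReal_le_ofReal ?_
    calc ‖tailProj q ψ‖ ^ 2 * Real.exp (-2 * t / T)
        ≤ (Real.pi * B * Real.exp (1 / (2 * T) * t)) ^ 2 * Real.exp (-2 * t / T) := by gcongr
      _ = (Real.pi * B) ^ 2 * (Real.exp (1 / (2 * T) * t) ^ 2 * Real.exp (-2 * t / T)) := by ring
      _ = _ := by
        rw [← Real.exp_nat_mul, ← Real.exp_add]
        congr 2
        field_simp
        push_cast
        ring
  have hneg : -(1 / T) < 0 := by simpa using hT
  calc _ ≤ ENNReal.ofReal (2 / T) * ∫⁻ t in Set.Ioi (0 : ℝ),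
        ENNReal.ofReal ((Real.pi * B) ^ 2 * Real.exp (-(1 / T) * t)) := by
        exact mul_le_mul' le_rfl (setLIntegral_mono' measurableSet_Ioi hpt)
    _ = ENNReal.ofReal (2 / T) * ENNReal.ofReal ((Real.pi * B) ^ 2 * T) := by
        rw [← ofReal_integral_eq_lintegral_ofReal
          ((integrableOn_exp_mul_Ioi hneg 0).const_mul _)
          (Filter.Eventually.of_forall fun t => by positivity), integral_const_mul,
          integral_exp_mul_Ioi hneg]
        congr 3
        simp
    _ = _ := by
        rw [← ENNReal.ofReal_mul (by positivity)]
        congr 1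
        field_simp

end HalfLine

/-! ### Superpolynomial decay and the choice of scales -/

namespace HalfLine

open Polynomial

/-- The power of `T`: the resolvent bound costs `η⁻⁵`, of order `T⁵`, and the two exceptional zeros
cost `T²` in `1/R`; squaring gives `T¹⁴`. The condition on `log (1 / (4Tε))` makes each zero of the
cluster gain at least `1`. -/
theorem outsideProb_le_of_isClustered (V : ℕ → ℝ) (hV : ∃ C : ℝ, ∀ n, |V n| ≤ C) :
    ∃ K : ℝ, 0 < K ∧ ∀ (q : ℕ) (ε ξ r T : ℝ), 1 < q → 0 < ε → 0 < ξ → ξ ≤ 1 →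
      IsClustered (eigenvalueSet V q) q ε ξ → 1 ≤ T → 2 ≤ Real.log (1 / (4 * T * ε)) →
      2 ≤ (q : ℝ) ^ ξ → (q : ℝ) ≤ r →
      outsideProb V hV r T ≤ ENNReal.ofReal (K * T ^ 14 * Real.exp (-(q : ℝ) ^ ξ)) := by
  obtain ⟨C, hC⟩ := id hV
  have hC0 : 0 ≤ C := (abs_nonneg _).trans (hC 0)
  set K₁ : ℝ := 2 + 2 * Real.log (4 * C + 10) with hK₁
  refine ⟨2 * Real.pi ^ 2 * (1600 * (C + 3) ^ 2) ^ 2 * Real.exp (2 * K₁), by positivity, ?_⟩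
  intro q ε ξ r T hq hε hξ hξ1 hcl hT hlog hY hqr
  have hT0 : 0 < T := zero_lt_one.trans_le hT
  set Y := (q : ℝ) ^ ξ with hYdef
  have hlogT : 0 ≤ Real.log T := Real.log_nonneg hT
  have hlogC : 0 ≤ Real.log (4 * C + 10) := Real.log_nonneg (by linarith)
  -- The cluster bound would allow `Y` in place of `Y / 2`. Halving gives `R ≤ 2^q`, since `Y ≤ q`
  -- and `log 2 ≥ 1/2`, as the quadratic growth bound requires.
  set R := Real.exp (Y / 2 - K₁ - 2 * Real.log T) with hR
  set η : ℝ := 1 / (2 * T) with hηdef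
  have hη : 0 < η := by positivity
  have hη1 : η ≤ 1 := by
    rw [hηdef, div_le_one (by positivity)]; linarith
  have hηinv : 1 / η = 2 * T := by rw [hηdef, one_div_one_div]
  have hηε' : η / (2 * ε) = 1 / (4 * T * ε) := by
    rw [hηdef]; field_simp; norm_num
  have hηε : 2 * ε ≤ η := by
    have h1 : 1 < 1 / (4 * T * ε) := by
      by_contra! h
      have := Real.log_nonpos (by positivity) h
      linarith
    rw [← hηε'] at h1
    exact ((one_lt_div (by positivity)).1 h1).le
  have hRq : R ≤ 2 ^ q := by
    have h1 : Y ≤ q := by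
      calc Y ≤ (q : ℝ) ^ (1 : ℝ) :=
            Real.rpow_le_rpow_of_exponent_le (by exact_mod_cast hq.le) hξ1
        _ = q := Real.rpow_one _
    have h2 : (2 : ℝ) ^ q = Real.exp (q * Real.log 2) := by
      rw [mul_comm, Real.exp_mul, Real.exp_log two_pos, Real.rpow_natCast]
    rw [h2, hR, Real.exp_le_exp]
    have h3 : (1 / 2 : ℝ) ≤ Real.log 2 := by linarith [Real.log_two_gt_d9]
    nlinarith
  have hRΔ : ∀ x : ℝ, R ≤ ‖aeval ((x : ℂ) + η * Complex.I) (discriminant V q)‖ := by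
    intro x
    have hpos : 0 < ‖aeval ((x : ℂ) + η * Complex.I) (discriminant V q)‖ := by
      rw [norm_aeval_discriminant hq.le]
      refine Finset.prod_pos fun E _ => norm_pos_iff.2 fun h => ?_
      have := congrArg Complex.im h
      simp at this
      exact hη.ne' this
    have h := log_discriminant_lower hq hC hξ hε hcl hη hηε hη1 x
    rw [hR, ← Real.le_log_iff_exp_le hpos]
    refine le_trans ?_ h
    rw [hηε', show (2 * C + 5) / η = (4 * C + 10) * T by
      rw [div_eq_mul_one_div, hηinv]; ring, Real.log_mul (by positivity) hT0.ne']
    have h1 : (Y - 2) * 1 ≤ (Y - 2) * (1 / 2 * Real.log (1 / (4 * T * ε))) :=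
      mul_le_mul_of_nonneg_left (by linarith) (by linarith)
    linarith
  have hR0 : 0 < R := Real.exp_pos _
  have hquad := discriminant_quadratic_lower (η := η) hq hC hRq hRΔ hR0.le
  set B : ℝ := (1 + 1 / η ^ 2) ^ 2 / η * (32 * (C + 3) ^ 2) / R with hB
  have hbound : ∀ x : ℝ, ‖tailProj q (resolventVec V hV ((x : ℂ) + η * Complex.I))‖ ≤
      B / (1 + x ^ 2) := by
    intro x
    have him : ((x : ℂ) + η * Complex.I).im = η := by simp
    have h := norm_tailProj_resolventVec V hV (z := (x : ℂ) + η * Complex.I)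
      (by rw [him]; exact hη) hq.le
    rw [him] at h
    have hx : 0 < 1 + x ^ 2 := by positivity
    have h2 := (mul_le_mul_of_nonneg_right (hquad x)
      (norm_nonneg (tailProj q (resolventVec V hV ((x : ℂ) + η * Complex.I))))).trans h
    rw [hB, le_div_iff₀ hx, le_div_iff₀ hR0]
    have hc : 0 < 32 * (C + 3) ^ 2 := by positivity
    rw [div_mul_eq_mul_div, div_le_iff₀ hc] at h2
    linarith
  refine (outsideProb_le V hV hq.le hqr hT0 hbound).trans (ENNReal.ofReal_le_ofReal ?_)
  have hBle : B ≤ 1600 * (C + 3) ^ 2 * T ^ 5 / R := by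
    refine div_le_div_of_nonneg_right ?_ hR0.le
    have h1 : 1 / η ^ 2 = 4 * T ^ 2 := by
      rw [← one_div_pow, hηinv]; ring
    rw [h1, div_eq_mul_one_div, hηinv]
    have h2 : 1 + 4 * T ^ 2 ≤ 5 * T ^ 2 := by nlinarith
    calc (1 + 4 * T ^ 2) ^ 2 * (2 * T) * (32 * (C + 3) ^ 2)
        ≤ (5 * T ^ 2) ^ 2 * (2 * T) * (32 * (C + 3) ^ 2) := by gcongr
      _ = _ := by ring
  have hB0 : 0 ≤ B := by positivity
  have hR2 : R ^ 2 * T ^ 4 = Real.exp Y * Real.exp (-(2 * K₁)) := by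
    have h1 : T ^ 4 = Real.exp (4 * Real.log T) := by
      rw [mul_comm, Real.exp_mul, Real.exp_log hT0]; norm_cast
    rw [hR, h1, ← Real.exp_nat_mul, ← Real.exp_add, ← Real.exp_add]
    congr 1
    push_cast; ring
  have hR3 : 1 / R ^ 2 = T ^ 4 * Real.exp (2 * K₁) * Real.exp (-Y) := by
    rw [div_eq_iff (by positivity)]
    calc (1 : ℝ) = (Real.exp Y * Real.exp (-Y)) * (Real.exp (-(2 * K₁)) * Real.exp (2 * K₁)) := by
          rw [← Real.exp_add, ← Real.exp_add]; simp
      _ = (R ^ 2 * T ^ 4) * (Real.exp (-Y) * Real.exp (2 * K₁)) := by rw [hR2]; ring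
      _ = _ := by ring
  calc 2 * (Real.pi * B) ^ 2 ≤ 2 * (Real.pi * (1600 * (C + 3) ^ 2 * T ^ 5 / R)) ^ 2 := by gcongr
    _ = 2 * Real.pi ^ 2 * (1600 * (C + 3) ^ 2) ^ 2 * T ^ 10 * (1 / R ^ 2) := by
        field_simp
    _ = _ := by rw [hR3]; ring

theorem logRate_le {V : ℕ → ℝ} {hV : ∃ C : ℝ, ∀ n, |V n| ≤ C} {a T K N Y : ℝ} (hT : 1 < T)
    (hK : 0 < K) (hP : outsideProb V hV (T ^ a) T ≤ ENNReal.ofReal (K * T ^ 14 * Real.exp (-Y)))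
    (hY : Real.log K + (14 + N) * Real.log T ≤ Y) : logRate V hV a T ≤ ((-N : ℝ) : EReal) := by
  have hlog : 0 < Real.log T := Real.log_pos hT
  have hT0 : 0 < T := zero_lt_one.trans hT
  have h1 : K * T ^ 14 * Real.exp (-Y) ≤ Real.exp (-N * Real.log T) := by
    have h2 : K * T ^ 14 * Real.exp (-Y) = Real.exp (Real.log K + 14 * Real.log T - Y) := by
      rw [sub_eq_add_neg, Real.exp_add, Real.exp_add, Real.exp_log hK, mul_comm 14, Real.exp_mul,
        Real.exp_log hT0]
      norm_cast
    rw [h2, Real.exp_le_exp]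
    linarith
  have h3 : ENNReal.log (outsideProb V hV (T ^ a) T) ≤ ((-N * Real.log T : ℝ) : EReal) := by
    refine (ENNReal.log_monotone (hP.trans (ENNReal.ofReal_le_ofReal h1))).trans_eq ?_
    rw [ENNReal.log_ofReal_of_pos (Real.exp_pos _), Real.log_exp]
  calc logRate V hV a T ≤ ((-N * Real.log T : ℝ) : EReal) / ((Real.log T : ℝ) : EReal) :=
        EReal.div_le_div_right_of_nonneg (by exact_mod_cast hlog.le) h3
    _ = _ := by rw [← EReal.coe_div, mul_div_cancel_right₀ _ hlog.ne']

theorem eventually_log_le_rpow {ξ : ℝ} (hξ : 0 < ξ) (K c : ℝ) :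
    ∀ᶠ n : ℕ in atTop, K + c * Real.log n ≤ (n : ℝ) ^ ξ := by
  have h1 : (fun x : ℝ => K + c * Real.log x) =o[atTop] fun x : ℝ => x ^ ξ := by
    refine Asymptotics.IsLittleO.add ?_ ((isLittleO_log_rpow_atTop hξ).const_mul_left c)
    refine Asymptotics.isLittleO_const_left.2 (Or.inr ?_)
    exact tendsto_norm_atTop_atTop.comp (tendsto_rpow_atTop hξ)
  have h2 := h1.bound one_pos
  filter_upwards [tendsto_natCast_atTop_atTop.eventually h2] with n hn
  rw [one_mul, Real.norm_of_nonneg (Real.rpow_nonneg (Nat.cast_nonneg n) ξ)] at hn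
  exact (le_abs_self _).trans hn

/-- Along scales comparable to `T^a` with `a > α`, the outside probability decays faster than any
power of the time. -/
theorem logRate_le_of_comparable (V : ℕ → ℝ) (hV : ∃ C : ℝ, ∀ n, |V n| ≤ C) {ξ α a : ℝ}
    (hξ : 0 < ξ) (hξ1 : ξ ≤ 1) (hα : 0 < α) (ha : α < a) (N : ℕ) {Λ : ℝ} (hΛ : 1 ≤ Λ) :
    ∀ᶠ q : ℕ in atTop, IsClustered (eigenvalueSet V q) q ((q : ℝ) ^ (-(1 / α))) ξ →
      ∀ T : ℝ, 0 < T → (q : ℝ) ≤ T ^ a → T ^ a ≤ Λ * q →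
        logRate V hV a T ≤ ((-N : ℝ) : EReal) := by
  obtain ⟨K, hK, hP⟩ := outsideProb_le_of_isClustered V hV
  have ha0 : 0 < a := hα.trans ha
  -- The decisive exponent: `T` is at most of order `q^(1/a)` and `ε = q^(-1/α)`, so `log (1 /
  -- (Tε))` is at least this multiple of `log q`, up to a constant.
  have hδ : 0 < 1 / α - 1 / a := sub_pos.2 (one_div_lt_one_div_of_lt hα ha)
  have hlim : Tendsto (fun n : ℕ => (1 / α - 1 / a) * Real.log n) atTop atTop :=
    (Real.tendsto_log_atTop.comp tendsto_natCast_atTop_atTop).const_mul_atTop hδ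
  filter_upwards [eventually_gt_atTop 1,
    hlim.eventually_ge_atTop (2 + Real.log 4 + Real.log Λ / a),
    eventually_log_le_rpow hξ 2 0,
    eventually_log_le_rpow hξ (Real.log K + (14 + N) * (Real.log Λ / a)) ((14 + N) / a)]
    with q hq h1 h2 h3 hcl T hT hqT hTq
  have hq0 : (0 : ℝ) < q := by exact_mod_cast zero_lt_one.trans hq
  have hq1 : (1 : ℝ) < q := by exact_mod_cast hq
  have hlq : 0 < Real.log q := Real.log_pos hq1
  have hL1 : Real.log q ≤ a * Real.log T := by
    rw [← Real.log_rpow hT]; exact Real.log_le_log hq0 hqT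
  have hL2 : a * Real.log T ≤ Real.log Λ + Real.log q := by
    rw [← Real.log_rpow hT, ← Real.log_mul (by positivity) hq0.ne']
    exact Real.log_le_log (by positivity) hTq
  have hlT : 0 < Real.log T := by
    by_contra! h
    nlinarith
  have hT1 : 1 < T := (Real.log_pos_iff hT.le).1 hlT
  have hlT' : Real.log T ≤ Real.log Λ / a + Real.log q / a := by
    rw [← add_div, le_div_iff₀ ha0]; linarith
  have hε : (0 : ℝ) < (q : ℝ) ^ (-(1 / α)) := Real.rpow_pos_of_pos hq0 _
  have hlog : 2 ≤ Real.log (1 / (4 * T * (q : ℝ) ^ (-(1 / α)))) := by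
    rw [Real.log_div one_ne_zero (by positivity), Real.log_one, Real.log_mul (by positivity) hε.ne',
      Real.log_mul (by norm_num) hT.ne', Real.log_rpow hq0]
    have : (1 / α - 1 / a) * Real.log q = 1 / α * Real.log q - Real.log q / a := by ring
    linarith
  refine logRate_le hT1 hK (hP q _ ξ (T ^ a) T hq hε hξ hξ1 hcl hT1.le hlog (by simpa using h2) hqT)
    (le_trans ?_ h3)
  have h4 : (14 + (N : ℝ)) * Real.log T ≤
      (14 + N) * (Real.log Λ / a + Real.log q / a) :=
    mul_le_mul_of_nonneg_left hlT' (by positivity)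
  have h5 : (14 + (N : ℝ)) * (Real.log Λ / a + Real.log q / a) =
      (14 + N) * (Real.log Λ / a) + (14 + N) / a * Real.log q := by ring
  linarith

theorem eq_bot_of_forall_le_neg {x : EReal} (h : ∀ N : ℕ, x ≤ ((-N : ℝ) : EReal)) : x = ⊥ := by
  by_contra hx
  obtain ⟨y, -, hy⟩ := EReal.lt_iff_exists_real_btwn.1 (bot_lt_iff_ne_bot.2 hx)
  obtain ⟨N, hN⟩ := exists_nat_ge (-y)
  have h2 : ((-N : ℝ) : EReal) ≤ (y : EReal) := by
    rw [EReal.coe_le_coe_iff]; linarith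
  exact absurd (hy.trans_le ((h N).trans h2)) (lt_irrefl _)

/-- A sequence with bounded successive quotients comes close to every large number from below. -/
theorem exists_le_lt_succ {q : ℕ → ℕ} (hq : Tendsto q atTop atTop) {l₀ : ℕ} {x : ℝ}
    (hx : (q l₀ : ℝ) ≤ x) : ∃ l ≥ l₀, (q l : ℝ) ≤ x ∧ x < q (l + 1) := by
  classical
  have hex : ∃ n, l₀ ≤ n ∧ x < q n := by
    have h := (tendsto_natCast_atTop_atTop (R := ℝ)).comp hq
    obtain ⟨n, h1, h2⟩ := ((h.eventually_gt_atTop x).and (eventually_ge_atTop l₀)).exists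
    exact ⟨n, h2, h1⟩
  obtain ⟨h1, h2⟩ := Nat.find_spec hex
  have hne : Nat.find hex ≠ l₀ := fun h => by
    rw [h] at h2; linarith
  obtain ⟨l, hl⟩ : ∃ l, Nat.find hex = l + 1 := ⟨Nat.find hex - 1, by omega⟩
  refine ⟨l, by omega, ?_, by rw [← hl]; exact h2⟩
  have := Nat.find_min hex (m := l) (by omega)
  push Not at this
  exact this (by omega)

end HalfLine

theorem mainTheorem7 (V : ℕ → ℝ) (hV : ∃ C : ℝ, ∀ n, |V n| ≤ C)
    (ξ α : ℝ) (hξ : 2 / 3 < ξ) (hξ' : ξ ≤ 1) (hα : 0 < α) (hα' : α < 1)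
    (q : ℕ → ℕ) (hq : ∀ l, 1 < q l) (hq' : Tendsto q atTop atTop)
    (hcl : ∀ l, HalfLine.IsClustered (HalfLine.eigenvalueSet V (q l)) (q l)
      ((q l : ℝ) ^ (-(1 / α))) ξ) :
    HalfLine.alphaUpperMinus V hV ≤ ENNReal.ofReal α ∧
      (HalfLine.ExponentiallyGrowing (fun l => (q l : ℝ)) →
        HalfLine.alphaUpperPlus V hV ≤ ENNReal.ofReal α) := by
  have hξ0 : 0 < ξ := by linarith
  constructor
  · refine sSup_le ?_
    rintro _ ⟨a, ⟨ha0, ha⟩, rfl⟩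
    refine ENNReal.ofReal_le_ofReal (le_of_not_gt fun hαa => ha.ne' ?_)
    refine HalfLine.eq_bot_of_forall_le_neg fun N => liminf_le_of_frequently_le ?_
    have hcomp := hq'.eventually
      (HalfLine.logRate_le_of_comparable V hV hξ0 hξ' hα hαa N le_rfl)
    -- A liminf needs only a sequence of times: those with `T^a = q l`, so the comparison constant
    -- is `1`.
    have hlim : Tendsto (fun l => (q l : ℝ) ^ (1 / a)) atTop atTop :=
      (tendsto_rpow_atTop (by positivity)).comp (tendsto_natCast_atTop_atTop.comp hq')
    refine hlim.frequently (Eventually.frequently ?_)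
    filter_upwards [hcomp] with l hl
    have hq0 : (0 : ℝ) < q l := by exact_mod_cast zero_lt_one.trans (hq l)
    have hpow : ((q l : ℝ) ^ (1 / a)) ^ a = q l := by
      rw [← Real.rpow_mul hq0.le, one_div_mul_cancel ha0.ne', Real.rpow_one]
    exact hl (hcl l) _ (Real.rpow_pos_of_pos hq0 _) hpow.ge (by rw [hpow, one_mul])
  · rintro ⟨-, ⟨Λ, hΛ⟩, -⟩
    refine sSup_le ?_
    rintro _ ⟨a, ⟨ha0, ha⟩, rfl⟩
    refine ENNReal.ofReal_le_ofReal (le_of_not_gt fun hαa => ha.ne' ?_)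
    refine HalfLine.eq_bot_of_forall_le_neg fun N => limsup_le_of_le (by isBoundedDefault) ?_
    obtain ⟨l₀, hl₀⟩ := eventually_atTop.1 (hq'.eventually
      (HalfLine.logRate_le_of_comparable V hV hξ0 hξ' hα hαa N (le_max_left 1 Λ)))
    filter_upwards [(tendsto_rpow_atTop ha0).eventually_ge_atTop (q l₀ : ℝ),
      eventually_gt_atTop 0] with T hT hT0
    -- For the limsup every large `T` must be treated: `T^a` lies between consecutive `q l`, and the
    -- bound `Λ` on their ratios makes it comparable to the smaller one.
    obtain ⟨l, hl, h1, h2⟩ := HalfLine.exists_le_lt_succ hq' hT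
    refine hl₀ l hl (hcl l) T hT0 h1 ?_
    have hq0 : (0 : ℝ) < q l := by exact_mod_cast zero_lt_one.trans (hq l)
    have h3 : (q (l + 1) : ℝ) / q l ≤ Λ := hΛ ⟨l, rfl⟩
    rw [div_le_iff₀ hq0] at h3
    exact h2.le.trans (h3.trans (mul_le_mul_of_nonneg_right (le_max_right 1 Λ) hq0.le))
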